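/- Let $L\ge 1$, let $X\sim\mathcal N(0,\Sigma_X)$ be a Gaussian vector in $\mathbb R^L$ with $\Sigma_X\succ 0$, and let $\Sigma_X=\Theta^T\mathrm{diag}(\lambda_1,\dots,\lambda_L)\,\Theta$ with $\Theta$ orthogonal. Let the perception loss $\phi(P_X,P_{\hat X})$ be either the Kullback–Leibler divergence $D(P_{\hat X}\|P_X)$ or the squared Wasserstein-2 distance $W_2^2(P_X,P_{\hat X})$. Let $$R(D,P)=\inf\{\,I(X;\hat X)\;:\;\mathbb E\|X-\hat X\|^2\le D,\ \phi(P_X,P_{\hat X})\le P\,\},$$ where the infimum is over all conditional distributions $P_{\hat X|X}$ on $\mathbb R^L$ and information is measured in nats. The water levels $\gamma^*_\ell(D,P)$ are the $\gamma$-components of the optimal solution of the program: minimize $\frac12\sum_{\ell=1}^L\log\frac{\lambda_\ell}{\gamma_\ell}$ over $(\gamma_\ell,\hat\lambda_\ell)_{\ell=1}^L$ subject to $0<\gamma_\ell\le\lambda_\ell$, $\hat\lambda_\ell\ge 0$, $\sum_\ell\bigl(\lambda_\ell-2\sqrt{\hat\lambda_\ell(\lambda_\ell-\gamma_\ell)}+\hat\lambda_\ell\bigr)\le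 D$ and $\sum_\ell P_\ell(\hat\lambda_\ell)\le P$, where $P_\ell(\hat\lambda_\ell)=\frac12\bigl(\frac{\hat\lambda_\ell}{\lambda_\ell}-1+\log\frac{\lambda_\ell}{\hat\lambda_\ell}\bigr)$ (with $P_\ell(0)=+\infty$) for the Kullback–Leibler divergence and $P_\ell(\hat\lambda_\ell)=(\sqrt{\lambda_\ell}-\sqrt{\hat\lambda_\ell})^2$ for the squared Wasserstein-2 distance. Then, for all sufficiently small $\epsilon>0$, $R(\epsilon,0)$ is finite, the water levels $\gamma^*_\ell(\epsilon,0)$ exist and are unique, and, as $\epsilon\to 0^+$, $$R(\epsilon,0)=\frac12\sum_{\ell=1}^L\log\frac{L\lambda_\ell}{\epsilon}+\frac{\epsilon}{8L}\sum_{\ell=1}^L\frac1{\lambda_\ell}+O(\epsilon^2),$$ $$\gamma^*_\ell(\epsilon,0)=\frac{\epsilon}{L}-\frac{\epsilon^2}{2L^2\lambda_\ell}+\frac{\epsilon^2}{4L^3}\sum_{k=1}^L\frac1{\lambda_k}+O(\epsilon^3),\qquad \ell=1,\dots,L,$$ where the implied constants may depend on $L$ and $\lambda_1,\dots,\lambda_L$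 but not on $\epsilon$. -/

import Mathlib

open MeasureTheory ProbabilityTheory Filter Topology Asymptotics
open scoped ENNReal

noncomputable section

/-- Expected squared-error distortion `E ‖U - V‖²` of a pair `(U, V)` with joint law `π`,
as an extended nonnegative real. -/
def expectedDistortion {L : ℕ}
    (π : Measure (EuclideanSpace ℝ (Fin L) × EuclideanSpace ℝ (Fin L))) : ℝ≥0∞ :=
  ∫⁻ p, ENNReal.ofReal (‖p.1 - p.2‖ ^ 2) ∂π

/-- Squared Wasserstein-2 distance: the infimum of `E ‖U - V‖²` over all joint laws with
marginals `μ` and `ν`. -/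
def wassersteinTwoSq {L : ℕ} (μ ν : Measure (EuclideanSpace ℝ (Fin L))) : ℝ≥0∞ :=
  sInf {r | ∃ π : Measure (EuclideanSpace ℝ (Fin L) × EuclideanSpace ℝ (Fin L)),
    π.map Prod.fst = μ ∧ π.map Prod.snd = ν ∧ r = expectedDistortion π}

/-- Mutual information `I(X; X̂)` (in nats) of the pair with `X ∼ μ` and conditional law `κ` of
`X̂` given `X`: the divergence of the joint law from the product of the marginals. -/
def mutualInformation {L : ℕ} (μ : Measure (EuclideanSpace ℝ (Fin L)))
    (κ : Kernel (EuclideanSpace ℝ (Fin L)) (EuclideanSpace ℝ (Fin L))) : ℝ≥0∞ :=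
  InformationTheory.klDiv (μ ⊗ₘ κ) (μ.prod (κ ∘ₘ μ))

/-- The two perception metrics. -/
inductive PerceptionMetric
  | kl
  | wasserstein

/-- Perception loss `φ(P_X, P_X̂)`: either `D(P_X̂ ‖ P_X)` or `W₂²(P_X, P_X̂)`. -/
def PerceptionMetric.loss {L : ℕ} (m : PerceptionMetric)
    (PX PXhat : Measure (EuclideanSpace ℝ (Fin L))) : ℝ≥0∞ :=
  match m with
  | .kl => InformationTheory.klDiv PXhat PX
  | .wasserstein => wassersteinTwoSq PX PXhat

/-- The information rate-distortion-perception function `R(D, P)` of a source with law `μ`: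
the infimum of `I(X; X̂)` over all conditional laws of `X̂` given `X` with
`E ‖X - X̂‖² ≤ D` and `φ(P_X, P_X̂) ≤ P`. -/
def rdpFunction {L : ℕ} (m : PerceptionMetric) (μ : Measure (EuclideanSpace ℝ (Fin L)))
    (D P : ℝ≥0∞) : ℝ≥0∞ :=
  sInf {r | ∃ κ : Kernel (EuclideanSpace ℝ (Fin L)) (EuclideanSpace ℝ (Fin L)),
    IsMarkovKernel κ ∧ expectedDistortion (μ ⊗ₘ κ) ≤ D ∧ m.loss μ (κ ∘ₘ μ) ≤ P ∧
      r = mutualInformation μ κ}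

/-- Distortion of a component of variance `lam` with water level `g` and reconstruction
variance `lamHat`. -/
def componentDistortion (lam g lamHat : ℝ) : ℝ :=
  lam - 2 * √(lamHat * (lam - g)) + lamHat

/-- Perception loss of a component of variance `lam > 0` reconstructed with variance
`lamHat ≥ 0`. In the divergence case the value at `lamHat = 0` is `+∞`, the value of
`(1 / 2) (lamHat / lam - 1 + log (lam / lamHat))` there. -/
def PerceptionMetric.componentLoss (m : PerceptionMetric) (lam lamHat : ℝ) : ℝ≥0∞ :=
  match m with
  | .kl =>
      if lamHat = 0 then ⊤
      else ENNReal.ofReal (1 / 2 * (lamHat / lam - 1 + Real.log (lam / lamHat)))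
  | .wasserstein => ENNReal.ofReal ((√lam - √lamHat) ^ 2)

/-- Feasible set of the water-filling program: pairs `(γ, lamHat)` with `0 < γ_ℓ ≤ lam_ℓ` and
`0 ≤ lamHat_ℓ` that meet the distortion budget `D` and the perception budget `P`. -/
def programFeasible {L : ℕ} (m : PerceptionMetric) (lam : Fin L → ℝ) (D P : ℝ≥0∞) :
    Set ((Fin L → ℝ) × (Fin L → ℝ)) :=
  {p | (∀ l, 0 < p.1 l ∧ p.1 l ≤ lam l) ∧ (∀ l, 0 ≤ p.2 l) ∧
    ENNReal.ofReal (∑ l, componentDistortion (lam l) (p.1 l) (p.2 l)) ≤ D ∧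
    ∑ l, m.componentLoss (lam l) (p.2 l) ≤ P}

/-- Objective of the water-filling program. -/
def programRate {L : ℕ} (lam g : Fin L → ℝ) : ℝ :=
  1 / 2 * ∑ l, Real.log (lam l / g l)

/-- `g` is a vector of water levels for `(D, P)`: the `γ`-part of an optimal solution
`(γ, lamHat)` of the water-filling program. -/
def IsWaterLevels {L : ℕ} (m : PerceptionMetric) (lam : Fin L → ℝ) (D P : ℝ≥0∞)
    (g : Fin L → ℝ) : Prop :=
  ∃ lamHat : Fin L → ℝ, (g, lamHat) ∈ programFeasible m lam D P ∧
    IsMinOn (fun p : (Fin L → ℝ) × (Fin L → ℝ) => programRate lam p.1)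
      (programFeasible m lam D P) (g, lamHat)

end

/-! Zero perception loss, under either metric, forces the reconstruction to have the law of `X`. So
`R(D, 0)` is the least mutual information of a coupling of that law with itself. After rotation by
`Θ` the coordinates are independent Gaussians of variances `v l`. Because both marginals are fixed,
the distortion is `2 * (∑ v l - E ∑ C l * C' l)`, so it depends only on the total correlation.

Let `f` be the log-density of the coupling by independent Gaussian pairs with correlations `r l`.
Under any coupling, the mean of `f` is affine in the cross moments, with weights `r l / (v l * (1 -
r l ^ 2))`. If these weights equal a common `c ≥ 0` (the stationarity condition), the mean is a
nondecreasing function of the total correlation alone. The Donsker–Varadhan bound with this `f` then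
shows that the Gaussian coupling is optimal at its own distortion (`rdpFunction_zero_eq`). The same
multiplier solves the finite program, where a quadratic remainder gives uniqueness
(`isWaterLevels_zero_iff`).

With `t = 1 / c`, `r l` is the positive root of `v l * (1 - r ^ 2) = t * r`. The distortion budget
reads `∑ (t - (√(t ^ 2 + 4 * v l ^ 2) - 2 * v l)) = ε`, that is, `L * t - t ^ 2 * ∑ 1 / (4 * v l) +
O(t ^ 3) = ε`. Inverting gives `t = ε / L + (∑ 1 / (4 * v l)) * ε ^ 2 / L ^ 3 + O(ε ^ 3)`. The
levels are `t * r l` and the rate is `-(1 / 2) * ∑ log (t * r l / v l)`, so both expansions follow.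
-/

/-! ### Variational bound for the divergence and its equality case. -/

section Divergence

variable {α : Type*} [MeasurableSpace α]

/-- Donsker–Varadhan lower bound on the divergence, for a normalised exponential. -/
theorem ofReal_integral_le_klDiv (π Q : Measure α) [IsProbabilityMeasure π]
    [IsProbabilityMeasure Q] {f : α → ℝ} (hf : Integrable f π)
    (hexp : Integrable (fun x => Real.exp (f x)) Q) (h1 : ∫ x, Real.exp (f x) ∂Q = 1) :
    ENNReal.ofReal (∫ x, f x ∂π) ≤ InformationTheory.klDiv π Q := by
  by_cases htop : InformationTheory.klDiv π Q = ⊤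
  · simp [htop]
  obtain ⟨hac, hint⟩ := InformationTheory.klDiv_ne_top_iff.1 htop
  rw [InformationTheory.klDiv_of_ac_of_integrable hac hint]
  have := isProbabilityMeasure_tilted hexp
  -- The gap in the inequality is the divergence of `π` from the tilted measure `Q.tilted f`, which
  -- is nonnegative.
  have hnn := InformationTheory.integral_llr_add_sub_measure_univ_nonneg
    (hac.trans (absolutelyContinuous_tilted hexp))
    (integrable_llr_tilted_right hac hf hint hexp)
  rw [integral_llr_tilted_right hac hf hexp hint, h1] at hnn
  refine ENNReal.ofReal_le_ofReal ?_
  simp at hnn ⊢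
  linarith

/-- The divergence of a normalised exponential tilt from the base measure. -/
theorem klDiv_tilted_self (Q : Measure α) [IsProbabilityMeasure Q] {f : α → ℝ}
    (hfm : Measurable f) (hf : Integrable f (Q.tilted f))
    (hexp : Integrable (fun x => Real.exp (f x)) Q) (h1 : ∫ x, Real.exp (f x) ∂Q = 1) :
    InformationTheory.klDiv (Q.tilted f) Q = ENNReal.ofReal (∫ x, f x ∂(Q.tilted f)) := by
  have := isProbabilityMeasure_tilted hexp
  have hac := tilted_absolutelyContinuous Q f
  have hllr : llr (Q.tilted f) Q =ᵐ[Q.tilted f] f := by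
    filter_upwards [hac.ae_le (llr_tilted_left (Measure.AbsolutelyContinuous.refl Q) hexp
      hfm.aemeasurable), hac.ae_le (llr_self Q)] with x hx hx'
    rw [hx, hx', h1]
    simp
  rw [InformationTheory.klDiv_of_ac_of_integrable hac ((integrable_congr hllr).2 hf),
    integral_congr_ae hllr]
  simp

end Divergence

/-! ### Zero perception loss means equal laws. -/

section Perception

variable {L : ℕ}

/-- The integrand is at most `‖x - y‖ * ‖t‖`, since `s ↦ exp (i s)` is 1-Lipschitz. Splitting this
product with a weight `δ` leaves only the second moment of `x - y`. -/
theorem enorm_charFun_sub_le_expectedDistortion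
    {μ ν : Measure (EuclideanSpace ℝ (Fin L))} [IsProbabilityMeasure μ]
    {π : Measure (EuclideanSpace ℝ (Fin L) × EuclideanSpace ℝ (Fin L))}
    (hfst : π.map Prod.fst = μ) (hsnd : π.map Prod.snd = ν)
    (t : EuclideanSpace ℝ (Fin L)) {δ : ℝ} (hδ : 0 < δ) :
    ‖charFun μ t - charFun ν t‖ₑ ≤
      ENNReal.ofReal (δ * ‖t‖ ^ 2) + ENNReal.ofReal δ⁻¹ * expectedDistortion π := by
  have hπ : IsProbabilityMeasure π := by
    constructor
    rw [← measure_univ (μ := μ), ← hfst, Measure.map_apply measurable_fst MeasurableSet.univ]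
    simp
  have hi : ∀ g : EuclideanSpace ℝ (Fin L) × EuclideanSpace ℝ (Fin L) → EuclideanSpace ℝ (Fin L),
      Measurable g → Integrable (fun p => Complex.exp (inner ℝ (g p) t * Complex.I)) π := by
    intro g hg
    refine Integrable.of_bound (C := 1) (by fun_prop) (ae_of_all _ fun p => ?_)
    rw [Complex.norm_exp_ofReal_mul_I]
  rw [← hfst, ← hsnd, charFun_apply, charFun_apply, integral_map (by fun_prop) (by fun_prop),
    integral_map (by fun_prop) (by fun_prop),
    ← integral_sub (hi _ measurable_fst) (hi _ measurable_snd)]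
  refine (enorm_integral_le_lintegral_enorm _).trans ?_
  have hpt : ∀ p : EuclideanSpace ℝ (Fin L) × EuclideanSpace ℝ (Fin L),
      ‖Complex.exp (inner ℝ p.1 t * Complex.I) - Complex.exp (inner ℝ p.2 t * Complex.I)‖ₑ ≤
        ENNReal.ofReal (δ * ‖t‖ ^ 2) +
          ENNReal.ofReal δ⁻¹ * ENNReal.ofReal (‖p.1 - p.2‖ ^ 2) := by
    intro p
    have h1 : Complex.exp (inner ℝ p.1 t * Complex.I) - Complex.exp (inner ℝ p.2 t * Complex.I) =
        Complex.exp (inner ℝ p.2 t * Complex.I) *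
          (Complex.exp (Complex.I * (inner ℝ (p.1 - p.2) t : ℝ)) - 1) := by
      rw [mul_sub, ← Complex.exp_add, mul_one, inner_sub_left]
      congr 2
      push_cast
      ring
    rw [← ENNReal.ofReal_mul (by positivity), ← ENNReal.ofReal_add (by positivity) (by positivity),
      ← ofReal_norm, h1, norm_mul, Complex.norm_exp_ofReal_mul_I, one_mul]
    refine ENNReal.ofReal_le_ofReal (Real.norm_exp_I_mul_ofReal_sub_one_le.trans ?_)
    refine (norm_inner_le_norm _ _).trans ?_
    -- In the scaled variable `q` the claim becomes `q * ‖t‖ ≤ ‖t‖ ^ 2 + q ^ 2`, times `δ`.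
    obtain ⟨q, hq⟩ : ∃ q, ‖p.1 - p.2‖ = δ * q := ⟨δ⁻¹ * ‖p.1 - p.2‖, by field_simp⟩
    have h2 : δ⁻¹ * (δ * q) ^ 2 = δ * q ^ 2 := by field_simp
    rw [hq, h2]
    nlinarith [mul_nonneg hδ.le (sq_nonneg (‖t‖ - q)), mul_nonneg hδ.le (sq_nonneg ‖t‖),
      mul_nonneg hδ.le (sq_nonneg q)]
  refine (lintegral_mono hpt).trans ?_
  rw [lintegral_add_left measurable_const, lintegral_const_mul' _ _ ENNReal.ofReal_ne_top]
  simp [expectedDistortion]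

/-- No optimal coupling is needed: one of cost below `δ ^ 2`, used with weight `δ`, makes the
characteristic functions differ by `O(δ)` at each point. -/
theorem eq_of_wassersteinTwoSq_eq_zero {μ ν : Measure (EuclideanSpace ℝ (Fin L))}
    [IsProbabilityMeasure μ] [IsProbabilityMeasure ν] (h : wassersteinTwoSq μ ν = 0) :
    μ = ν := by
  refine Measure.ext_of_charFun (funext fun t => ?_)
  rw [← sub_eq_zero, ← enorm_eq_zero]
  have hle : ∀ δ : ℝ, 0 < δ →
      ‖charFun μ t - charFun ν t‖ₑ ≤ ENNReal.ofReal (δ * (‖t‖ ^ 2 + 1)) := by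
    intro δ hδ
    have hlt : wassersteinTwoSq μ ν < ENNReal.ofReal (δ ^ 2) := by
      rw [h]
      exact ENNReal.ofReal_pos.2 (by positivity)
    obtain ⟨r, ⟨π, h1, h2, rfl⟩, hr⟩ := sInf_lt_iff.1 hlt
    refine (enorm_charFun_sub_le_expectedDistortion h1 h2 t hδ).trans ?_
    refine (add_le_add_right (mul_le_mul_right hr.le _) _).trans ?_
    rw [← ENNReal.ofReal_mul (by positivity), ← ENNReal.ofReal_add (by positivity) (by positivity)]
    refine ENNReal.ofReal_le_ofReal (le_of_eq ?_)
    field_simp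
  have hlim : Tendsto (fun δ : ℝ => ENNReal.ofReal (δ * (‖t‖ ^ 2 + 1))) (𝓝[>] 0) (𝓝 0) := by
    have : Continuous (fun δ : ℝ => ENNReal.ofReal (δ * (‖t‖ ^ 2 + 1))) :=
      ENNReal.continuous_ofReal.comp (by fun_prop)
    simpa using (this.tendsto 0).mono_left nhdsWithin_le_nhds
  exact le_antisymm (ge_of_tendsto hlim (eventually_nhdsWithin_of_forall hle)) bot_le

theorem PerceptionMetric.eq_of_loss_eq_zero (m : PerceptionMetric)
    {μ ν : Measure (EuclideanSpace ℝ (Fin L))}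
    [IsProbabilityMeasure μ] [IsProbabilityMeasure ν] (h : m.loss μ ν = 0) : ν = μ := by
  cases m with
  | kl => exact InformationTheory.klDiv_eq_zero_iff.1 h
  | wasserstein => exact (eq_of_wassersteinTwoSq_eq_zero h).symm

theorem PerceptionMetric.loss_self (m : PerceptionMetric)
    (μ : Measure (EuclideanSpace ℝ (Fin L))) [IsProbabilityMeasure μ] : m.loss μ μ = 0 := by
  cases m with
  | kl => exact InformationTheory.klDiv_self μ
  | wasserstein =>
    refine le_antisymm (sInf_le ⟨μ.map fun x => (x, x), ?_, ?_, ?_⟩) bot_le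
    · rw [Measure.map_map measurable_fst (by fun_prop)]
      exact Measure.map_id
    · rw [Measure.map_map measurable_snd (by fun_prop)]
      exact Measure.map_id
    · rw [expectedDistortion, lintegral_map (by fun_prop) (by fun_prop)]
      simp

end Perception

/-! ### Correlated Gaussian pairs: density and conditional moments. -/

section Correlated

/-- Logarithm of the density, with respect to the product of its marginals, of a pair of
centred Gaussian variables of variance `v` and correlation `r`. -/
noncomputable def gaussianPairLogDensity (v r a b : ℝ) : ℝ :=
  -(1 / 2) * Real.log (1 - r ^ 2) -
    (r ^ 2 * a ^ 2 - 2 * r * a * b + r ^ 2 * b ^ 2) / (2 * (1 - r ^ 2) * v)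

theorem gaussianPairLogDensity_comm (v r a b : ℝ) :
    gaussianPairLogDensity v r a b = gaussianPairLogDensity v r b a := by
  unfold gaussianPairLogDensity
  ring

@[fun_prop]
theorem Measurable.gaussianPairLogDensity {α : Type*} [MeasurableSpace α] (v r : ℝ) {f g : α → ℝ}
    (hf : Measurable f) (hg : Measurable g) :
    Measurable fun x => _root_.gaussianPairLogDensity v r (f x) (g x) := by
  unfold _root_.gaussianPairLogDensity
  fun_prop

/-- Completing the square in `b`: given `a`, the partner is Gaussian with mean `r * a` and variance
`v * (1 - r ^ 2)`. -/
theorem exp_gaussianPairLogDensity_mul_pdf {v r : ℝ} (hv : 0 < v) (hr : 0 < 1 - r ^ 2)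
    (a b : ℝ) :
    Real.exp (gaussianPairLogDensity v r a b) * gaussianPDFReal 0 v.toNNReal b =
      gaussianPDFReal (r * a) (v * (1 - r ^ 2)).toNNReal b := by
  have h1 : Real.exp (-(1 / 2) * Real.log (1 - r ^ 2)) = (√(1 - r ^ 2))⁻¹ := by
    rw [show -(1 / 2) * Real.log (1 - r ^ 2) = -(Real.log (1 - r ^ 2) / 2) by ring,
      Real.exp_neg, Real.exp_half, Real.exp_log hr]
  rw [gaussianPDFReal, gaussianPDFReal, Real.coe_toNNReal _ hv.le,
    Real.coe_toNNReal _ (mul_pos hv hr).le, gaussianPairLogDensity, sub_eq_add_neg, Real.exp_add,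
    h1, show 2 * Real.pi * (v * (1 - r ^ 2)) = (2 * Real.pi * v) * (1 - r ^ 2) by ring,
    Real.sqrt_mul (by positivity : 0 ≤ 2 * Real.pi * v), mul_inv]
  have h2 : Real.exp (-((r ^ 2 * a ^ 2 - 2 * r * a * b + r ^ 2 * b ^ 2) /
        (2 * (1 - r ^ 2) * v))) * Real.exp (-(b - 0) ^ 2 / (2 * v)) =
      Real.exp (-(b - r * a) ^ 2 / (2 * (v * (1 - r ^ 2)))) := by
    rw [← Real.exp_add]
    congr 1
    have := hr.ne'
    field_simp
    ring
  rw [← h2]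
  ring

theorem gaussianReal_withDensity_pair {v r : ℝ} (hv : 0 < v) (hr : 0 < 1 - r ^ 2) (a : ℝ) :
    (gaussianReal 0 v.toNNReal).withDensity
        (fun b => ENNReal.ofReal (Real.exp (gaussianPairLogDensity v r a b))) =
      gaussianReal (r * a) (v * (1 - r ^ 2)).toNNReal := by
  have h1 : v.toNNReal ≠ 0 := by simpa using hv
  have h2 : (v * (1 - r ^ 2)).toNNReal ≠ 0 := by simpa using mul_pos hv hr
  rw [gaussianReal_of_var_ne_zero _ h1, gaussianReal_of_var_ne_zero _ h2,
    ← withDensity_mul _ (by fun_prop) (by fun_prop)]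
  congr 1
  ext b
  rw [Pi.mul_apply, gaussianPDF, gaussianPDF, mul_comm, ← ENNReal.ofReal_mul (by positivity),
    exp_gaussianPairLogDensity_mul_pdf hv hr]

theorem integral_exp_gaussianPairLogDensity_mul {v r : ℝ} (hv : 0 < v) (hr : 0 < 1 - r ^ 2)
    (a : ℝ) (h : ℝ → ℝ) :
    ∫ b, Real.exp (gaussianPairLogDensity v r a b) * h b ∂gaussianReal 0 v.toNNReal =
      ∫ b, h b ∂gaussianReal (r * a) (v * (1 - r ^ 2)).toNNReal := by
  rw [← gaussianReal_withDensity_pair hv hr, integral_withDensity_eq_integral_toReal_smul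
    (by fun_prop) (by simp)]
  refine integral_congr_ae (ae_of_all _ fun b => ?_)
  simp [ENNReal.toReal_ofReal (Real.exp_pos _).le]

theorem integrable_exp_gaussianPairLogDensity {v r : ℝ} (hv : 0 < v) (hr : 0 < 1 - r ^ 2)
    (a : ℝ) :
    Integrable (fun b => Real.exp (gaussianPairLogDensity v r a b))
      (gaussianReal 0 v.toNNReal) := by
  have h := (integrable_const (μ := gaussianReal (r * a) (v * (1 - r ^ 2)).toNNReal) (1 : ℝ))
  rw [← gaussianReal_withDensity_pair hv hr, integrable_withDensity_iff_integrable_smul'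
    (by fun_prop) (by simp)] at h
  simpa [ENNReal.toReal_ofReal (Real.exp_pos _).le] using h

variable {L : ℕ}

/-- Law on `Fin L → ℝ` of independent centred Gaussian variables of variances `v`. -/
noncomputable def independentGaussian (v : Fin L → ℝ) : Measure (Fin L → ℝ) :=
  Measure.pi fun l => gaussianReal 0 (v l).toNNReal

instance (v : Fin L → ℝ) : IsProbabilityMeasure (independentGaussian v) := by
  unfold independentGaussian
  infer_instance

/-- Logarithm of the joint density of independent pairs of correlated Gaussian variables, with
respect to the product of the marginals. -/
noncomputable def gaussianVectorLogDensity (v r a b : Fin L → ℝ) : ℝ :=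
  ∑ l, gaussianPairLogDensity (v l) (r l) (a l) (b l)

theorem gaussianVectorLogDensity_comm (v r a b : Fin L → ℝ) :
    gaussianVectorLogDensity v r a b = gaussianVectorLogDensity v r b a :=
  Finset.sum_congr rfl fun _ _ => gaussianPairLogDensity_comm _ _ _ _

theorem integrable_exp_gaussianVectorLogDensity {v r : Fin L → ℝ} (hv : ∀ l, 0 < v l)
    (hr : ∀ l, 0 < 1 - r l ^ 2) (a : Fin L → ℝ) :
    Integrable (fun b => Real.exp (gaussianVectorLogDensity v r a b)) (independentGaussian v) := by
  simp_rw [gaussianVectorLogDensity, Real.exp_sum]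
  exact Integrable.fintype_prod_dep
    (f := fun l b => Real.exp (gaussianPairLogDensity (v l) (r l) (a l) b))
    fun l => integrable_exp_gaussianPairLogDensity (hv l) (hr l) (a l)

theorem integral_exp_gaussianVectorLogDensity {v r : Fin L → ℝ} (hv : ∀ l, 0 < v l)
    (hr : ∀ l, 0 < 1 - r l ^ 2) (a : Fin L → ℝ) :
    ∫ b, Real.exp (gaussianVectorLogDensity v r a b) ∂independentGaussian v = 1 := by
  simp_rw [gaussianVectorLogDensity, Real.exp_sum, independentGaussian]
  rw [integral_fintype_prod_eq_prod
    (fun l b => Real.exp (gaussianPairLogDensity (v l) (r l) (a l) b))]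
  refine Finset.prod_eq_one fun l _ => ?_
  simpa using integral_exp_gaussianPairLogDensity_mul (hv l) (hr l) (a l) 1

theorem integral_exp_gaussianVectorLogDensity_mul_apply {v r : Fin L → ℝ} (hv : ∀ l, 0 < v l)
    (hr : ∀ l, 0 < 1 - r l ^ 2) (a : Fin L → ℝ) (l : Fin L) :
    ∫ b, Real.exp (gaussianVectorLogDensity v r a b) * b l ∂independentGaussian v =
      r l * a l := by
  -- The factor `b l` is absorbed into the `l`-th term so that the integral factorises over
  -- coordinates.
  have h : ∀ b : Fin L → ℝ, Real.exp (gaussianVectorLogDensity v r a b) * b l =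
      ∏ k, (Real.exp (gaussianPairLogDensity (v k) (r k) (a k) (b k)) *
        if k = l then b k else 1) := by
    intro b
    rw [Finset.prod_mul_distrib, gaussianVectorLogDensity, Real.exp_sum]
    simp
  simp_rw [h, independentGaussian]
  rw [integral_fintype_prod_eq_prod (fun k b =>
    Real.exp (gaussianPairLogDensity (v k) (r k) (a k) b) * if k = l then b else 1)]
  have h' : ∀ k, ∫ b, (Real.exp (gaussianPairLogDensity (v k) (r k) (a k) b) *
      if k = l then b else 1) ∂gaussianReal 0 (v k).toNNReal =
        if k = l then r k * a k else 1 := by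
    intro k
    rw [integral_exp_gaussianPairLogDensity_mul (hv k) (hr k) (a k)
      (fun b => if k = l then b else 1)]
    split_ifs <;> simp
  simp_rw [h']
  simp

end Correlated

/-! ### Couplings of a law with independent Gaussian coordinates. -/

section GaussianCoordinates

variable {L : ℕ}

theorem integral_sq_gaussianReal_zero {v : ℝ} (hv : 0 ≤ v) :
    ∫ x, x ^ 2 ∂gaussianReal 0 v.toNNReal = v := by
  have h := variance_id_gaussianReal (μ := 0) (v := v.toNNReal)
  rw [variance_of_integral_eq_zero (by fun_prop) (by simp)] at h
  simpa [Real.coe_toNNReal _ hv] using h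

@[fun_prop]
theorem Measurable.gaussianVectorLogDensity {β : Type*} [MeasurableSpace β] (v r : Fin L → ℝ)
    {f g : β → Fin L → ℝ} (hf : Measurable f) (hg : Measurable g) :
    Measurable fun x => _root_.gaussianVectorLogDensity v r (f x) (g x) := by
  unfold _root_.gaussianVectorLogDensity
  fun_prop

variable {α : Type*} [MeasurableSpace α] {μ : Measure α}
  {C : α → Fin L → ℝ} {v r : Fin L → ℝ}

theorem memLp_two_coordinate (hC : MeasurePreserving C μ (independentGaussian v)) (l : Fin L) :
    MemLp (fun x => C x l) 2 μ :=
  (memLp_id_gaussianReal (μ := 0) (v := (v l).toNNReal) 2).comp_measurePreserving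
    ((measurePreserving_eval (fun l => gaussianReal 0 (v l).toNNReal) l).comp hC)

theorem integral_coordinate_sq (hC : MeasurePreserving C μ (independentGaussian v))
    (hv : ∀ l, 0 < v l) (l : Fin L) : ∫ x, C x l ^ 2 ∂μ = v l := by
  have h := (measurePreserving_eval (fun l => gaussianReal 0 (v l).toNNReal) l).comp hC
  rw [← integral_sq_gaussianReal_zero (hv l).le, ← h.map_eq,
    integral_map h.aemeasurable (by fun_prop)]
  rfl

theorem integral_exp_logDensity_coordinate (hC : MeasurePreserving C μ (independentGaussian v))
    (hv : ∀ l, 0 < v l) (hr : ∀ l, 0 < 1 - r l ^ 2) (a : Fin L → ℝ) :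
    ∫ y, Real.exp (gaussianVectorLogDensity v r a (C y)) ∂μ = 1 := by
  rw [← integral_exp_gaussianVectorLogDensity hv hr a, ← hC.map_eq,
    integral_map hC.aemeasurable (Measurable.aestronglyMeasurable (by fun_prop))]

theorem integral_exp_logDensity_coordinate_mul
    (hC : MeasurePreserving C μ (independentGaussian v))
    (hv : ∀ l, 0 < v l) (hr : ∀ l, 0 < 1 - r l ^ 2) (a : Fin L → ℝ) (l : Fin L) :
    ∫ y, Real.exp (gaussianVectorLogDensity v r a (C y)) * C y l ∂μ = r l * a l := by
  rw [← integral_exp_gaussianVectorLogDensity_mul_apply hv hr a l, ← hC.map_eq,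
    integral_map hC.aemeasurable (Measurable.aestronglyMeasurable (by fun_prop))]

theorem integrable_exp_logDensity_coordinate
    (hC : MeasurePreserving C μ (independentGaussian v))
    (hv : ∀ l, 0 < v l) (hr : ∀ l, 0 < 1 - r l ^ 2) (a : Fin L → ℝ) :
    Integrable (fun y => Real.exp (gaussianVectorLogDensity v r a (C y))) μ := by
  have h := integrable_exp_gaussianVectorLogDensity hv hr a
  exact hC.integrable_comp_of_integrable h

theorem lintegral_exp_logDensity_coordinate
    (hC : MeasurePreserving C μ (independentGaussian v))
    (hv : ∀ l, 0 < v l) (hr : ∀ l, 0 < 1 - r l ^ 2) (a : Fin L → ℝ) :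
    ∫⁻ y, ENNReal.ofReal (Real.exp (gaussianVectorLogDensity v r a (C y))) ∂μ = 1 := by
  rw [← ofReal_integral_eq_lintegral_ofReal (integrable_exp_logDensity_coordinate hC hv hr a)
    (ae_of_all _ fun _ => (Real.exp_pos _).le), integral_exp_logDensity_coordinate hC hv hr]
  simp

section Probability

variable [IsProbabilityMeasure μ]

theorem integrable_exp_logDensity_prod
    (hC : MeasurePreserving C μ (independentGaussian v))
    (hv : ∀ l, 0 < v l) (hr : ∀ l, 0 < 1 - r l ^ 2) :
    Integrable (fun p : α × α => Real.exp (gaussianVectorLogDensity v r (C p.1) (C p.2)))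
      (μ.prod μ) := by
  have hm := hC.measurable
  rw [integrable_prod_iff (Measurable.aestronglyMeasurable (by fun_prop))]
  refine ⟨ae_of_all _ fun x => integrable_exp_logDensity_coordinate hC hv hr (C x), ?_⟩
  simp [integral_exp_logDensity_coordinate hC hv hr]

theorem integral_exp_logDensity_prod
    (hC : MeasurePreserving C μ (independentGaussian v))
    (hv : ∀ l, 0 < v l) (hr : ∀ l, 0 < 1 - r l ^ 2) :
    ∫ p : α × α, Real.exp (gaussianVectorLogDensity v r (C p.1) (C p.2)) ∂μ.prod μ = 1 := by
  rw [integral_prod _ (integrable_exp_logDensity_prod hC hv hr)]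
  simp [integral_exp_logDensity_coordinate hC hv hr]

/-- Gaussian coupling of `μ` with itself, with correlation `r l` in the `l`-th coordinate. -/
noncomputable def gaussianCoupling (μ : Measure α) (C : α → Fin L → ℝ) (v r : Fin L → ℝ) :
    Measure (α × α) :=
  (μ.prod μ).tilted fun p => gaussianVectorLogDensity v r (C p.1) (C p.2)

theorem isProbabilityMeasure_gaussianCoupling
    (hC : MeasurePreserving C μ (independentGaussian v))
    (hv : ∀ l, 0 < v l) (hr : ∀ l, 0 < 1 - r l ^ 2) :
    IsProbabilityMeasure (gaussianCoupling μ C v r) :=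
  isProbabilityMeasure_tilted (integrable_exp_logDensity_prod hC hv hr)

/-- By Tonelli the second variable integrates out, because for each fixed first variable the density
has total mass one. -/
theorem measurePreserving_fst_gaussianCoupling
    (hC : MeasurePreserving C μ (independentGaussian v))
    (hv : ∀ l, 0 < v l) (hr : ∀ l, 0 < 1 - r l ^ 2) :
    MeasurePreserving Prod.fst (gaussianCoupling μ C v r) μ := by
  have hm := hC.measurable
  refine ⟨measurable_fst, Measure.ext_of_lintegral _ fun g hg => ?_⟩
  rw [lintegral_map hg measurable_fst, gaussianCoupling, lintegral_tilted,
    integral_exp_logDensity_prod hC hv hr,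
    lintegral_prod _ (Measurable.aemeasurable (by fun_prop))]
  refine lintegral_congr fun x => ?_
  simp only [div_one]
  rw [lintegral_mul_const _ (by fun_prop)]
  simp [lintegral_exp_logDensity_coordinate hC hv hr]

theorem measurePreserving_snd_gaussianCoupling
    (hC : MeasurePreserving C μ (independentGaussian v))
    (hv : ∀ l, 0 < v l) (hr : ∀ l, 0 < 1 - r l ^ 2) :
    MeasurePreserving Prod.snd (gaussianCoupling μ C v r) μ := by
  have hm := hC.measurable
  refine ⟨measurable_snd, Measure.ext_of_lintegral _ fun g hg => ?_⟩
  rw [lintegral_map hg measurable_snd, gaussianCoupling, lintegral_tilted,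
    integral_exp_logDensity_prod hC hv hr,
    lintegral_prod_symm _ (Measurable.aemeasurable (by fun_prop))]
  refine lintegral_congr fun y => ?_
  simp_rw [gaussianVectorLogDensity_comm v r _ (C y)]
  simp only [div_one]
  rw [lintegral_mul_const _ (by fun_prop)]
  simp [lintegral_exp_logDensity_coordinate hC hv hr]

end Probability

section Coupling

variable {π : Measure (α × α)}

theorem integrable_coordinate_sq_fst (hC : MeasurePreserving C μ (independentGaussian v))
    (h1 : MeasurePreserving Prod.fst π μ) (l : Fin L) :
    Integrable (fun p : α × α => C p.1 l ^ 2) π :=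
  h1.integrable_comp_of_integrable (memLp_two_coordinate hC l).integrable_sq

theorem integrable_coordinate_sq_snd (hC : MeasurePreserving C μ (independentGaussian v))
    (h2 : MeasurePreserving Prod.snd π μ) (l : Fin L) :
    Integrable (fun p : α × α => C p.2 l ^ 2) π :=
  h2.integrable_comp_of_integrable (memLp_two_coordinate hC l).integrable_sq

theorem integrable_coordinate_mul (hC : MeasurePreserving C μ (independentGaussian v))
    (h1 : MeasurePreserving Prod.fst π μ) (h2 : MeasurePreserving Prod.snd π μ) (l : Fin L) :
    Integrable (fun p : α × α => C p.1 l * C p.2 l) π :=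
  ((memLp_two_coordinate hC l).comp_measurePreserving h1).integrable_mul
    ((memLp_two_coordinate hC l).comp_measurePreserving h2)

theorem integral_coordinate_sq_fst (hC : MeasurePreserving C μ (independentGaussian v))
    (hv : ∀ l, 0 < v l) (h1 : MeasurePreserving Prod.fst π μ) (l : Fin L) :
    ∫ p : α × α, C p.1 l ^ 2 ∂π = v l := by
  have hm := hC.measurable
  rw [← integral_coordinate_sq hC hv l, ← h1.map_eq,
    integral_map h1.aemeasurable (Measurable.aestronglyMeasurable (by fun_prop))]

theorem integral_coordinate_sq_snd (hC : MeasurePreserving C μ (independentGaussian v))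
    (hv : ∀ l, 0 < v l) (h2 : MeasurePreserving Prod.snd π μ) (l : Fin L) :
    ∫ p : α × α, C p.2 l ^ 2 ∂π = v l := by
  have hm := hC.measurable
  rw [← integral_coordinate_sq hC hv l, ← h2.map_eq,
    integral_map h2.aemeasurable (Measurable.aestronglyMeasurable (by fun_prop))]

variable [IsProbabilityMeasure π]

theorem integrable_gaussianPairLogDensity (hC : MeasurePreserving C μ (independentGaussian v))
    (h1 : MeasurePreserving Prod.fst π μ) (h2 : MeasurePreserving Prod.snd π μ) (l : Fin L) :
    Integrable (fun p : α × α => gaussianPairLogDensity (v l) (r l) (C p.1 l) (C p.2 l)) π := by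
  unfold gaussianPairLogDensity
  simp_rw [mul_assoc (2 * r l)]
  exact (integrable_const _).sub (((((integrable_coordinate_sq_fst hC h1 l).const_mul _).sub
    ((integrable_coordinate_mul hC h1 h2 l).const_mul _)).add
    ((integrable_coordinate_sq_snd hC h2 l).const_mul _)).div_const _)

/-- The log-density is quadratic and the marginals fix both second moments at `v l`, so only the
cross moment remains free. The constant is arranged to vanish at the cross moment `v l * r l` of the
Gaussian coupling. -/
theorem integral_gaussianPairLogDensity (hC : MeasurePreserving C μ (independentGaussian v))
    (hv : ∀ l, 0 < v l) (hr : ∀ l, 0 < 1 - r l ^ 2)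
    (h1 : MeasurePreserving Prod.fst π μ) (h2 : MeasurePreserving Prod.snd π μ) (l : Fin L) :
    ∫ p : α × α, gaussianPairLogDensity (v l) (r l) (C p.1 l) (C p.2 l) ∂π =
      -(1 / 2) * Real.log (1 - r l ^ 2) +
        r l / (v l * (1 - r l ^ 2)) * (∫ p : α × α, C p.1 l * C p.2 l ∂π - v l * r l) := by
  have i1 := (integrable_coordinate_sq_fst hC h1 l).const_mul (r l ^ 2)
  have i2 := (integrable_coordinate_sq_snd hC h2 l).const_mul (r l ^ 2)
  have i12 := (integrable_coordinate_mul hC h1 h2 l).const_mul (2 * r l)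
  unfold gaussianPairLogDensity
  simp_rw [mul_assoc (2 * r l)]
  have i3 : Integrable
      (fun p : α × α => r l ^ 2 * C p.1 l ^ 2 - 2 * r l * (C p.1 l * C p.2 l)) π := i1.sub i12
  have i4 : Integrable (fun p : α × α => r l ^ 2 * C p.1 l ^ 2 -
      2 * r l * (C p.1 l * C p.2 l) + r l ^ 2 * C p.2 l ^ 2) π := i3.add i2
  rw [integral_sub (integrable_const _) (i4.div_const _), integral_div, integral_add i3 i2,
    integral_sub i1 i12, integral_const, integral_const_mul,
    integral_const_mul, integral_const_mul, integral_coordinate_sq_fst hC hv h1 l,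
    integral_coordinate_sq_snd hC hv h2 l]
  have e1 := (hv l).ne'
  have e2 := (hr l).ne'
  simp only [probReal_univ, one_smul]
  field_simp
  ring

theorem integrable_gaussianVectorLogDensity (hC : MeasurePreserving C μ (independentGaussian v))
    (h1 : MeasurePreserving Prod.fst π μ) (h2 : MeasurePreserving Prod.snd π μ) :
    Integrable (fun p : α × α => gaussianVectorLogDensity v r (C p.1) (C p.2)) π :=
  integrable_finsetSum _ fun l _ => integrable_gaussianPairLogDensity hC h1 h2 l

/-- When `r l / (1 - r l ^ 2)` is proportional to `v l`, the mean of the Gaussian log-density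
under a coupling depends on the coupling only through its total correlation. -/
theorem integral_gaussianVectorLogDensity (hC : MeasurePreserving C μ (independentGaussian v))
    (hv : ∀ l, 0 < v l) (hr : ∀ l, 0 < 1 - r l ^ 2) {c : ℝ}
    (hc : ∀ l, r l = c * (v l * (1 - r l ^ 2)))
    (h1 : MeasurePreserving Prod.fst π μ) (h2 : MeasurePreserving Prod.snd π μ) :
    ∫ p : α × α, gaussianVectorLogDensity v r (C p.1) (C p.2) ∂π =
      ∑ l, -(1 / 2) * Real.log (1 - r l ^ 2) +
        c * (∫ p : α × α, ∑ l, C p.1 l * C p.2 l ∂π - ∑ l, v l * r l) := by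
  unfold gaussianVectorLogDensity
  rw [integral_finsetSum _ fun l _ => integrable_gaussianPairLogDensity hC h1 h2 l,
    integral_finsetSum _ fun l _ => integrable_coordinate_mul hC h1 h2 l,
    ← Finset.sum_sub_distrib, Finset.mul_sum, ← Finset.sum_add_distrib]
  refine Finset.sum_congr rfl fun l _ => ?_
  rw [integral_gaussianPairLogDensity hC hv hr h1 h2 l]
  have : r l / (v l * (1 - r l ^ 2)) = c := by
    rw [div_eq_iff (mul_pos (hv l) (hr l)).ne']
    exact hc l
  rw [this]

end Coupling

/-- Conditioning on the first variable replaces the second by its conditional mean, `r l` times the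
first. -/
theorem integral_coordinate_mul_gaussianCoupling [IsProbabilityMeasure μ]
    (hC : MeasurePreserving C μ (independentGaussian v))
    (hv : ∀ l, 0 < v l) (hr : ∀ l, 0 < 1 - r l ^ 2) (l : Fin L) :
    ∫ p : α × α, C p.1 l * C p.2 l ∂gaussianCoupling μ C v r = v l * r l := by
  have hint := integrable_coordinate_mul hC (measurePreserving_fst_gaussianCoupling hC hv hr)
    (measurePreserving_snd_gaussianCoupling hC hv hr) l
  rw [gaussianCoupling, integrable_tilted_iff (integrable_exp_logDensity_prod hC hv hr)] at hint
  rw [gaussianCoupling, integral_tilted, integral_exp_logDensity_prod hC hv hr]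
  simp only [div_one, smul_eq_mul] at hint ⊢
  rw [integral_prod _ hint]
  have h : ∀ x, ∫ y, Real.exp (gaussianVectorLogDensity v r (C x) (C y)) * (C x l * C y l) ∂μ =
      r l * C x l ^ 2 := by
    intro x
    simp_rw [mul_left_comm _ (C x l)]
    rw [integral_const_mul, integral_exp_logDensity_coordinate_mul hC hv hr]
    ring
  simp_rw [h]
  rw [integral_const_mul, integral_coordinate_sq hC hv, mul_comm]

end GaussianCoordinates

/-! ### The rate-distortion function at zero perception loss. -/

section RateDistortion

variable {L : ℕ}

theorem expectedDistortion_eq_ofReal {μ : Measure (EuclideanSpace ℝ (Fin L))}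
    {C : EuclideanSpace ℝ (Fin L) → Fin L → ℝ} {v : Fin L → ℝ}
    (hC : MeasurePreserving C μ (independentGaussian v))
    (hinner : ∀ x y, ∑ l, C x l * C y l = inner ℝ x y) (hv : ∀ l, 0 < v l)
    {π : Measure (EuclideanSpace ℝ (Fin L) × EuclideanSpace ℝ (Fin L))}
    (h1 : MeasurePreserving Prod.fst π μ) (h2 : MeasurePreserving Prod.snd π μ) :
    expectedDistortion π =
      ENNReal.ofReal (2 * (∑ l, v l - ∫ p, ∑ l, C p.1 l * C p.2 l ∂π)) := by
  have hnorm : ∀ p : EuclideanSpace ℝ (Fin L) × EuclideanSpace ℝ (Fin L),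
      ‖p.1 - p.2‖ ^ 2 =
        ∑ l, (C p.1 l ^ 2 + C p.2 l ^ 2 - 2 * (C p.1 l * C p.2 l)) := by
    intro p
    rw [norm_sub_sq_real, ← real_inner_self_eq_norm_sq, ← real_inner_self_eq_norm_sq,
      ← hinner, ← hinner, ← hinner, Finset.mul_sum, ← Finset.sum_sub_distrib,
      ← Finset.sum_add_distrib]
    refine Finset.sum_congr rfl fun l _ => ?_
    ring
  have i1 : ∀ l, Integrable (fun p : EuclideanSpace ℝ (Fin L) × EuclideanSpace ℝ (Fin L) =>
      C p.1 l ^ 2 + C p.2 l ^ 2) π := fun l =>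
    (integrable_coordinate_sq_fst hC h1 l).add (integrable_coordinate_sq_snd hC h2 l)
  have i2 := fun l => (integrable_coordinate_mul hC h1 h2 l).const_mul 2
  have i3 : ∀ l, Integrable (fun p : EuclideanSpace ℝ (Fin L) × EuclideanSpace ℝ (Fin L) =>
      C p.1 l ^ 2 + C p.2 l ^ 2 - 2 * (C p.1 l * C p.2 l)) π := fun l => (i1 l).sub (i2 l)
  rw [expectedDistortion, ← ofReal_integral_eq_lintegral_ofReal]
  · simp_rw [hnorm]
    congr 1
    rw [integral_finsetSum _ fun l _ => i3 l,
      integral_finsetSum _ fun l _ => integrable_coordinate_mul hC h1 h2 l,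
      ← Finset.sum_sub_distrib, Finset.mul_sum]
    refine Finset.sum_congr rfl fun l _ => ?_
    rw [integral_sub (i1 l) (i2 l), integral_add (integrable_coordinate_sq_fst hC h1 l)
      (integrable_coordinate_sq_snd hC h2 l), integral_const_mul,
      integral_coordinate_sq_fst hC hv h1, integral_coordinate_sq_snd hC hv h2]
    ring
  · simp_rw [hnorm]
    exact integrable_finsetSum _ fun l _ => i3 l
  · exact ae_of_all _ fun p => by positivity

/-- The rate-distortion function of a Gaussian vector under perfect perceptual quality, in terms
of the correlations `r l` of the components of the optimal coupling. -/
theorem rdpFunction_zero_eq (m : PerceptionMetric) {μ : Measure (EuclideanSpace ℝ (Fin L))}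
    [IsProbabilityMeasure μ] {C : EuclideanSpace ℝ (Fin L) → Fin L → ℝ} {v r : Fin L → ℝ}
    (hC : MeasurePreserving C μ (independentGaussian v))
    (hinner : ∀ x y, ∑ l, C x l * C y l = inner ℝ x y) (hv : ∀ l, 0 < v l)
    (hr : ∀ l, 0 < 1 - r l ^ 2) {c : ℝ} (hc0 : 0 ≤ c)
    (hc : ∀ l, r l = c * (v l * (1 - r l ^ 2))) :
    rdpFunction m μ (ENNReal.ofReal (∑ l, 2 * v l * (1 - r l))) 0 =
      ENNReal.ofReal (∑ l, -(1 / 2) * Real.log (1 - r l ^ 2)) := by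
  have hD : ∑ l, 2 * v l * (1 - r l) = 2 * (∑ l, v l - ∑ l, v l * r l) := by
    rw [← Finset.sum_sub_distrib, Finset.mul_sum]
    exact Finset.sum_congr rfl fun l _ => by ring
  have hD0 : 0 ≤ ∑ l, 2 * v l * (1 - r l) :=
    Finset.sum_nonneg fun l _ => mul_nonneg (by linarith [hv l]) (by nlinarith [hr l])
  have hexp := integrable_exp_logDensity_prod hC hv hr
  have hone := integral_exp_logDensity_prod hC hv hr
  refine le_antisymm ?_ ?_
  · have hG := isProbabilityMeasure_gaussianCoupling hC hv hr
    have h1 := measurePreserving_fst_gaussianCoupling hC hv hr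
    have h2 := measurePreserving_snd_gaussianCoupling hC hv hr
    have hcorr : ∫ p, ∑ l, C p.1 l * C p.2 l ∂gaussianCoupling μ C v r = ∑ l, v l * r l := by
      rw [integral_finsetSum _ fun l _ => integrable_coordinate_mul hC h1 h2 l]
      exact Finset.sum_congr rfl fun l _ => integral_coordinate_mul_gaussianCoupling hC hv hr l
    -- Disintegration over the first marginal turns the Gaussian coupling into an admissible
    -- conditional law.
    have hfst : (gaussianCoupling μ C v r).fst = μ := h1.map_eq
    have hprod : μ ⊗ₘ (gaussianCoupling μ C v r).condKernel = gaussianCoupling μ C v r := by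
      have h := Measure.disintegrate (gaussianCoupling μ C v r)
        (gaussianCoupling μ C v r).condKernel
      rwa [hfst] at h
    have hsnd : (gaussianCoupling μ C v r).condKernel ∘ₘ μ = μ := by
      rw [← Measure.snd_compProd, hprod]
      exact h2.map_eq
    refine sInf_le ⟨(gaussianCoupling μ C v r).condKernel, inferInstance, ?_, ?_, ?_⟩
    · rw [hprod, expectedDistortion_eq_ofReal hC hinner hv h1 h2, hcorr, hD]
    · rw [hsnd, m.loss_self]
    · have hm := hC.measurable
      rw [mutualInformation, hprod, hsnd]
      refine Eq.trans ?_ (klDiv_tilted_self (μ.prod μ) (by fun_prop)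
        (integrable_gaussianVectorLogDensity (r := r) (π := gaussianCoupling μ C v r) hC h1 h2)
        hexp hone).symm
      have := integral_gaussianVectorLogDensity hC hv hr hc h1 h2
      rw [hcorr, sub_self, mul_zero, add_zero] at this
      rw [← this, gaussianCoupling]
  · refine le_sInf ?_
    rintro _ ⟨κ, hκ, hdist, hloss, rfl⟩
    have hsnd : κ ∘ₘ μ = μ := m.eq_of_loss_eq_zero (le_antisymm hloss bot_le)
    have h1 : MeasurePreserving Prod.fst (μ ⊗ₘ κ) μ := ⟨measurable_fst, Measure.fst_compProd _ _⟩
    have h2 : MeasurePreserving Prod.snd (μ ⊗ₘ κ) μ :=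
      ⟨measurable_snd, (Measure.snd_compProd _ _).trans hsnd⟩
    -- The distortion bound says that the total correlation is at least `∑ l, v l * r l`. Since `c ≥
    -- 0`, this bounds the mean log-density from below.
    rw [expectedDistortion_eq_ofReal hC hinner hv h1 h2, ENNReal.ofReal_le_ofReal_iff hD0, hD]
      at hdist
    rw [mutualInformation, hsnd]
    refine le_trans (ENNReal.ofReal_le_ofReal ?_) (ofReal_integral_le_klDiv _ _
      (integrable_gaussianVectorLogDensity (r := r) hC h1 h2) hexp hone)
    rw [integral_gaussianVectorLogDensity hC hv hr hc h1 h2]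
    have := mul_nonneg hc0 (a := c) (b := ∫ p, ∑ l, C p.1 l * C p.2 l ∂(μ ⊗ₘ κ) - ∑ l, v l * r l)
      (by linarith)
    linarith

end RateDistortion

/-! ### Rotation of the Gaussian source to independent coordinates. -/

section Diagonalization

variable {L : ℕ}

theorem map_multivariateGaussian_eq {covX Θ : Matrix (Fin L) (Fin L) ℝ} {lam : Fin L → ℝ}
    (hcov : covX.PosSemidef) (hΘ : Θ ∈ Matrix.orthogonalGroup (Fin L) ℝ)
    (hdecomp : covX = Θ.transpose * Matrix.diagonal lam * Θ) (hlam : ∀ l, 0 ≤ lam l) :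
    (multivariateGaussian 0 covX).map (Matrix.toEuclideanCLM (𝕜 := ℝ) Θ) =
      (independentGaussian lam).map (WithLp.toLp 2) := by
  refine Measure.ext_of_charFun (funext fun t => ?_)
  have hadj : ∀ x, inner ℝ (Matrix.toEuclideanCLM (𝕜 := ℝ) Θ x) t =
      inner ℝ x (Matrix.toEuclideanCLM (𝕜 := ℝ) Θ.transpose t) := by
    intro x
    rw [real_inner_comm, Matrix.inner_toEuclideanCLM, Matrix.inner_toEuclideanCLM,
      Matrix.dotProduct_mulVec, ← Matrix.mulVec_transpose, dotProduct_comm]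
  have h1 : charFun ((multivariateGaussian 0 covX).map (Matrix.toEuclideanCLM (𝕜 := ℝ) Θ)) t =
      charFun (multivariateGaussian 0 covX) (Matrix.toEuclideanCLM (𝕜 := ℝ) Θ.transpose t) := by
    rw [charFun_apply, charFun_apply, integral_map (by fun_prop) (by fun_prop)]
    simp_rw [hadj]
  have horth : Θ * Θ.transpose = 1 := (Matrix.mem_orthogonalGroup_iff _ _).1 hΘ
  have h2 : (Matrix.toEuclideanCLM (𝕜 := ℝ) Θ.transpose t).ofLp ⬝ᵥ
      covX.mulVec (Matrix.toEuclideanCLM (𝕜 := ℝ) Θ.transpose t).ofLp =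
        ∑ l, lam l * t l ^ 2 := by
    rw [Matrix.ofLp_toEuclideanCLM, Matrix.mulVec_mulVec, hdecomp, Matrix.mul_assoc,
      Matrix.mul_assoc, horth, Matrix.mul_one, ← Matrix.mulVec_mulVec, Matrix.dotProduct_mulVec,
      ← Matrix.mulVec_transpose, Matrix.transpose_transpose, Matrix.mulVec_mulVec, horth,
      Matrix.one_mulVec]
    simp only [dotProduct, Matrix.mulVec_diagonal]
    exact Finset.sum_congr rfl fun l _ => by ring
  rw [h1, charFun_multivariateGaussian hcov, h2, independentGaussian, charFun_pi]
  simp_rw [charFun_gaussianReal]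
  rw [← Complex.exp_sum]
  congr 1
  simp [Finset.sum_div, Real.coe_toNNReal _ (hlam _)]

theorem measurePreserving_orthogonal_coordinates {covX Θ : Matrix (Fin L) (Fin L) ℝ}
    {lam : Fin L → ℝ} (hcov : covX.PosSemidef) (hΘ : Θ ∈ Matrix.orthogonalGroup (Fin L) ℝ)
    (hdecomp : covX = Θ.transpose * Matrix.diagonal lam * Θ) (hlam : ∀ l, 0 ≤ lam l) :
    MeasurePreserving (fun x : EuclideanSpace ℝ (Fin L) => Θ.mulVec x.ofLp)
      (multivariateGaussian 0 covX) (independentGaussian lam) := by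
  have hm : Measurable fun x : EuclideanSpace ℝ (Fin L) => Θ.mulVec x.ofLp := by
    have : (fun x : EuclideanSpace ℝ (Fin L) => Θ.mulVec x.ofLp) =
        fun x => (Matrix.toEuclideanCLM (𝕜 := ℝ) Θ x).ofLp := by
      ext x
      rw [Matrix.ofLp_toEuclideanCLM]
    rw [this]
    fun_prop
  refine ⟨hm, ?_⟩
  have h := congrArg (Measure.map (WithLp.ofLp (p := 2)))
    (map_multivariateGaussian_eq hcov hΘ hdecomp hlam)
  rw [Measure.map_map (by fun_prop) (by fun_prop), Measure.map_map (by fun_prop) (by fun_prop)] at h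
  have e1 : (WithLp.ofLp (p := 2)) ∘ (Matrix.toEuclideanCLM (𝕜 := ℝ) Θ) =
      fun x : EuclideanSpace ℝ (Fin L) => Θ.mulVec x.ofLp := by
    ext x
    simp
  have e2 : (WithLp.ofLp (p := 2)) ∘ (WithLp.toLp 2) = (id : (Fin L → ℝ) → Fin L → ℝ) := rfl
  rwa [e1, e2, Measure.map_id] at h

theorem sum_orthogonal_coordinates_mul {Θ : Matrix (Fin L) (Fin L) ℝ}
    (hΘ : Θ ∈ Matrix.orthogonalGroup (Fin L) ℝ) (x y : EuclideanSpace ℝ (Fin L)) :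
    ∑ l, Θ.mulVec x.ofLp l * Θ.mulVec y.ofLp l = inner ℝ x y := by
  have horth : Θ.transpose * Θ = 1 := (Matrix.mem_orthogonalGroup_iff' _ _).1 hΘ
  change Θ.mulVec x.ofLp ⬝ᵥ Θ.mulVec y.ofLp = _
  rw [Matrix.dotProduct_mulVec, ← Matrix.mulVec_transpose, Matrix.mulVec_mulVec, horth,
    Matrix.one_mulVec, PiLp.inner_apply]
  exact Finset.sum_congr rfl fun l _ => mul_comm _ _

theorem pos_of_posDef_orthogonal {covX Θ : Matrix (Fin L) (Fin L) ℝ} {lam : Fin L → ℝ}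
    (hcov : covX.PosDef) (hΘ : Θ ∈ Matrix.orthogonalGroup (Fin L) ℝ)
    (hdecomp : covX = Θ.transpose * Matrix.diagonal lam * Θ) (l : Fin L) : 0 < lam l := by
  have horth : Θ * Θ.transpose = 1 := (Matrix.mem_orthogonalGroup_iff _ _).1 hΘ
  have hdiag : (Matrix.diagonal lam).PosDef := by
    have hinj : Function.Injective Θ.vecMul := by
      intro a b hab
      have := congrArg (fun w => Matrix.vecMul w Θ.transpose) hab
      simpa [Matrix.vecMul_vecMul, horth] using this
    have h := hcov.mul_mul_conjTranspose_same hinj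
    rw [Matrix.conjTranspose_eq_transpose_of_trivial, hdecomp] at h
    have e : Θ * (Θ.transpose * Matrix.diagonal lam * Θ) * Θ.transpose =
        (Θ * Θ.transpose) * Matrix.diagonal lam * (Θ * Θ.transpose) := by
      simp only [Matrix.mul_assoc]
    rwa [e, horth, Matrix.one_mul, Matrix.mul_one] at h
  exact Matrix.posDef_diagonal_iff.1 hdiag l

end Diagonalization

/-! ### The water-filling program at zero perception loss. -/

section Program

theorem PerceptionMetric.componentLoss_eq_zero_iff (m : PerceptionMetric) {v w : ℝ} (hv : 0 < v)
    (hw : 0 ≤ w) : m.componentLoss v w = 0 ↔ w = v := by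
  cases m with
  | kl =>
    simp only [componentLoss]
    split_ifs with h
    · simp [h, hv.ne]
    have hw' : 0 < w := lt_of_le_of_ne hw (Ne.symm h)
    rw [ENNReal.ofReal_eq_zero]
    refine ⟨fun hle => ?_, ?_⟩
    · by_contra hne
      have h1 : w / v ≠ 1 := by rwa [Ne, div_eq_one_iff_eq hv.ne']
      have h2 := Real.log_lt_sub_one_of_pos (div_pos hw' hv) h1
      have h3 : Real.log (v / w) = -Real.log (w / v) := by rw [← Real.log_inv, inv_div]
      rw [h3] at hle
      linarith
    · rintro rfl
      simp [hw'.ne']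
  | wasserstein =>
    simp only [componentLoss]
    rw [ENNReal.ofReal_eq_zero]
    refine ⟨fun hle => ?_, ?_⟩
    · have h0 : √v - √w = 0 := by
        have := le_antisymm hle (sq_nonneg _)
        simpa using this
      exact ((Real.sqrt_inj hv.le hw).1 (sub_eq_zero.1 h0)).symm
    · rintro rfl
      simp

variable {L : ℕ}

theorem sum_componentLoss_le_zero_iff (m : PerceptionMetric) {v w : Fin L → ℝ}
    (hv : ∀ l, 0 < v l) (hw : ∀ l, 0 ≤ w l) :
    ∑ l, m.componentLoss (v l) (w l) ≤ 0 ↔ w = v := by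
  rw [nonpos_iff_eq_zero, Finset.sum_eq_zero_iff, funext_iff]
  exact ⟨fun h l => (m.componentLoss_eq_zero_iff (hv l) (hw l)).1 (h l (Finset.mem_univ l)),
    fun h l _ => (m.componentLoss_eq_zero_iff (hv l) (hw l)).2 (h l)⟩

theorem componentDistortion_self {v r : ℝ} (hv : 0 < v) (hr : 0 ≤ r) :
    componentDistortion v (v * (1 - r ^ 2)) v = 2 * v * (1 - r) := by
  rw [componentDistortion, show v * (v - v * (1 - r ^ 2)) = (v * r) ^ 2 by ring,
    Real.sqrt_sq (mul_nonneg hv.le hr)]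
  ring

/-- This is `log x ≤ x - 1` at `x = (1 - q ^ 2) / (1 - r ^ 2)`. Since `x - 1` is quadratic in `q`,
its expansion at `r` is exact, and the square term later yields uniqueness. -/
theorem neg_half_log_one_sub_sq_lower_bound {q r : ℝ} (hq : 0 < 1 - q ^ 2) (hr : 0 < 1 - r ^ 2) :
    -(1 / 2) * Real.log (1 - r ^ 2) + (r / (1 - r ^ 2)) * (q - r) +
        (q - r) ^ 2 / (2 * (1 - r ^ 2)) ≤
      -(1 / 2) * Real.log (1 - q ^ 2) := by
  have h := Real.log_le_sub_one_of_pos (div_pos hq hr)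
  rw [Real.log_div hq.ne' hr.ne'] at h
  have e : (r / (1 - r ^ 2)) * (q - r) + (q - r) ^ 2 / (2 * (1 - r ^ 2)) =
      -(1 / 2) * ((1 - q ^ 2) / (1 - r ^ 2) - 1) := by
    field_simp
    ring
  linarith

theorem programRate_eq {v r : Fin L → ℝ} (hv : ∀ l, 0 < v l) :
    programRate v (fun l => v l * (1 - r l ^ 2)) =
      ∑ l, -(1 / 2) * Real.log (1 - r l ^ 2) := by
  rw [programRate, Finset.mul_sum]
  refine Finset.sum_congr rfl fun l _ => ?_
  rw [div_mul_cancel_left₀ (hv l).ne', Real.log_inv]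
  ring

theorem exists_water_level_parametrization {v g : Fin L → ℝ} (hv : ∀ l, 0 < v l)
    (hg : ∀ l, 0 < g l ∧ g l ≤ v l) :
    ∃ q : Fin L → ℝ, (∀ l, 0 ≤ q l) ∧ (∀ l, 0 < 1 - q l ^ 2) ∧
      g = fun l => v l * (1 - q l ^ 2) := by
  have hsq : ∀ l, √((v l - g l) / v l) ^ 2 = (v l - g l) / v l := fun l =>
    Real.sq_sqrt (div_nonneg (sub_nonneg.2 (hg l).2) (hv l).le)
  have he : ∀ l, 1 - (v l - g l) / v l = g l / v l := fun l => by
    have := (hv l).ne'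
    field_simp
    ring
  refine ⟨fun l => √((v l - g l) / v l), fun l => Real.sqrt_nonneg _, fun l => ?_, ?_⟩
  · rw [hsq, he]
    exact div_pos (hg l).1 (hv l)
  · ext l
    rw [hsq, he, mul_div_cancel₀ _ (hv l).ne']

theorem mem_programFeasible_zero_iff (m : PerceptionMetric) {v q w : Fin L → ℝ}
    (hv : ∀ l, 0 < v l) (hq0 : ∀ l, 0 ≤ q l) (hq : ∀ l, 0 < 1 - q l ^ 2) {D : ℝ} (hD : 0 ≤ D) :
    ((fun l => v l * (1 - q l ^ 2)), w) ∈ programFeasible m v (ENNReal.ofReal D) 0 ↔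
      w = v ∧ ∑ l, 2 * v l * (1 - q l) ≤ D := by
  have hself : ∑ l, componentDistortion (v l) (v l * (1 - q l ^ 2)) (v l) =
      ∑ l, 2 * v l * (1 - q l) :=
    Finset.sum_congr rfl fun l _ => componentDistortion_self (hv l) (hq0 l)
  constructor
  · rintro ⟨-, hw, hdist, hloss⟩
    have hwv : w = v := (sum_componentLoss_le_zero_iff m hv hw).1 hloss
    refine ⟨hwv, ?_⟩
    dsimp only at hdist
    rwa [hwv, hself, ENNReal.ofReal_le_ofReal_iff hD] at hdist
  · rintro ⟨rfl, hdist⟩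
    refine ⟨fun l => ⟨mul_pos (hv l) (hq l), ?_⟩, fun l => (hv l).le, ?_,
      (sum_componentLoss_le_zero_iff m hv fun l => (hv l).le).2 rfl⟩
    · nlinarith [mul_nonneg (hv l).le (sq_nonneg (q l))]
    · dsimp only
      rw [hself]
      exact ENNReal.ofReal_le_ofReal hdist

/-- Lagrangian duality: the stationarity condition turns the linear terms into `c / 2` times the
distortion slack, which is nonnegative after summation. -/
theorem rate_lower_bound_of_distortion_le {v q r : Fin L → ℝ}
    (hq : ∀ l, 0 < 1 - q l ^ 2) (hr : ∀ l, 0 < 1 - r l ^ 2) {c : ℝ} (hc0 : 0 ≤ c)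
    (hc : ∀ l, r l = c * (v l * (1 - r l ^ 2)))
    (hdist : ∑ l, 2 * v l * (1 - q l) ≤ ∑ l, 2 * v l * (1 - r l)) :
    ∑ l, -(1 / 2) * Real.log (1 - r l ^ 2) + ∑ l, (q l - r l) ^ 2 / (2 * (1 - r l ^ 2)) ≤
      ∑ l, -(1 / 2) * Real.log (1 - q l ^ 2) := by
  have h : ∀ l, -(1 / 2) * Real.log (1 - r l ^ 2) + (q l - r l) ^ 2 / (2 * (1 - r l ^ 2)) +
      c / 2 * (2 * v l * (1 - r l) - 2 * v l * (1 - q l)) ≤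
        -(1 / 2) * Real.log (1 - q l ^ 2) := by
    intro l
    have h1 := neg_half_log_one_sub_sq_lower_bound (hq l) (hr l)
    have h2 : r l / (1 - r l ^ 2) = c * v l := by
      rw [div_eq_iff (hr l).ne', mul_assoc]
      exact hc l
    rw [h2] at h1
    linarith
  have hsum := Finset.sum_le_sum fun l (_ : l ∈ Finset.univ) => h l
  rw [Finset.sum_add_distrib, Finset.sum_add_distrib, ← Finset.mul_sum Finset.univ _ (c / 2),
    Finset.sum_sub_distrib] at hsum
  have := mul_nonneg (div_nonneg hc0 two_pos.le) (sub_nonneg.2 hdist)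
  linarith

/-- Under perfect perceptual quality the unique water levels are `v l * (1 - r l ^ 2)`, when
`r l / (1 - r l ^ 2)` is proportional to `v l` and `r` exhausts the distortion budget. -/
theorem isWaterLevels_zero_iff (m : PerceptionMetric) {v r : Fin L → ℝ}
    (hv : ∀ l, 0 < v l) (hr0 : ∀ l, 0 ≤ r l) (hr : ∀ l, 0 < 1 - r l ^ 2) {c : ℝ} (hc0 : 0 ≤ c)
    (hc : ∀ l, r l = c * (v l * (1 - r l ^ 2))) (g : Fin L → ℝ) :
    IsWaterLevels m v (ENNReal.ofReal (∑ l, 2 * v l * (1 - r l))) 0 g ↔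
      g = fun l => v l * (1 - r l ^ 2) := by
  have hD0 : 0 ≤ ∑ l, 2 * v l * (1 - r l) :=
    Finset.sum_nonneg fun l _ => mul_nonneg (by linarith [hv l]) (by nlinarith [hr l])
  have hmem := (mem_programFeasible_zero_iff m hv hr0 hr hD0 (w := v)).2 ⟨rfl, le_rfl⟩
  have hquad : ∀ (q : Fin L → ℝ) l, 0 ≤ (q l - r l) ^ 2 / (2 * (1 - r l ^ 2)) := fun q l =>
    div_nonneg (sq_nonneg _) (by linarith [hr l])
  constructor
  · rintro ⟨w, hw, hmin⟩
    obtain ⟨q, hq0, hq, rfl⟩ := exists_water_level_parametrization hv hw.1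
    have hle := isMinOn_iff.1 hmin _ hmem
    obtain ⟨-, hdist⟩ := (mem_programFeasible_zero_iff m hv hq0 hq hD0).1 hw
    dsimp only at hle
    rw [programRate_eq hv, programRate_eq hv] at hle
    have hlow := rate_lower_bound_of_distortion_le hq hr hc0 hc hdist
    have hzero : ∑ l, (q l - r l) ^ 2 / (2 * (1 - r l ^ 2)) = 0 :=
      le_antisymm (by linarith) (Finset.sum_nonneg fun l _ => hquad q l)
    ext l
    have hl := (Finset.sum_eq_zero_iff_of_nonneg fun l _ => hquad q l).1 hzero l
      (Finset.mem_univ l)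
    rw [div_eq_zero_iff] at hl
    rcases hl with hl | hl
    · rw [sub_eq_zero.1 (pow_eq_zero_iff two_ne_zero |>.1 hl)]
    · linarith [hr l]
  · rintro rfl
    refine ⟨v, hmem, isMinOn_iff.2 ?_⟩
    rintro ⟨g, w⟩ hgw
    obtain ⟨q, hq0, hq, rfl⟩ := exists_water_level_parametrization hv hgw.1
    obtain ⟨-, hdist⟩ := (mem_programFeasible_zero_iff m hv hq0 hq hD0).1 hgw
    dsimp only
    rw [programRate_eq hv, programRate_eq hv]
    have hlow := rate_lower_bound_of_distortion_le hq hr hc0 hc hdist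
    have := Finset.sum_nonneg fun l (_ : l ∈ Finset.univ) => hquad q l
    linarith

end Program

/-! ### The optimal correlation as a function of the inverse multiplier. -/

section Correlation

/-- The root in `(0, 1)` of `v * (1 - r ^ 2) = t * r`: correlation of the optimal coupling of a
component of variance `v` at inverse multiplier `t`. -/
noncomputable def optimalCorrelation (v t : ℝ) : ℝ := (√(t ^ 2 + 4 * v ^ 2) - t) / (2 * v)

variable {v : ℝ}

theorem mul_one_sub_optimalCorrelation_sq (hv : 0 < v) (t : ℝ) :
    v * (1 - optimalCorrelation v t ^ 2) = t * optimalCorrelation v t := by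
  have hs := Real.sq_sqrt (show 0 ≤ t ^ 2 + 4 * v ^ 2 by positivity)
  rw [optimalCorrelation]
  generalize √(t ^ 2 + 4 * v ^ 2) = s at hs ⊢
  field_simp
  linear_combination -hs

theorem optimalCorrelation_pos (hv : 0 < v) (t : ℝ) : 0 < optimalCorrelation v t := by
  refine div_pos (sub_pos.2 ?_) (by linarith)
  exact Real.lt_sqrt_of_sq_lt (by nlinarith [mul_pos hv hv])

theorem one_sub_optimalCorrelation_sq (hv : 0 < v) (t : ℝ) :
    1 - optimalCorrelation v t ^ 2 = t * optimalCorrelation v t / v := by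
  rw [eq_div_iff hv.ne', mul_comm, mul_one_sub_optimalCorrelation_sq hv]

theorem one_sub_optimalCorrelation_sq_pos (hv : 0 < v) {t : ℝ} (ht : 0 < t) :
    0 < 1 - optimalCorrelation v t ^ 2 := by
  rw [one_sub_optimalCorrelation_sq hv]
  exact div_pos (mul_pos ht (optimalCorrelation_pos hv t)) hv

theorem optimalCorrelation_eq_add (hv : 0 < v) (t : ℝ) :
    optimalCorrelation v t = 1 + (√(t ^ 2 + 4 * v ^ 2) - 2 * v) / (2 * v) - t / (2 * v) := by
  rw [optimalCorrelation]
  field_simp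
  ring

theorem two_mul_le_sqrt_sq_add (v t : ℝ) : 0 ≤ √(t ^ 2 + 4 * v ^ 2) - 2 * v :=
  sub_nonneg.2 (Real.le_sqrt_of_sq_le (by nlinarith [sq_nonneg t]))

/-- With `x = √(t ^ 2 + 4 * v ^ 2) - 2 * v` this is `x ^ 2 + 4 * v * x = t ^ 2`, solved for the
linear term. Dropping the square bounds `x`; feeding that bound back gives the next order. -/
theorem sqrt_sq_add_sub_eq (hv : 0 < v) (t : ℝ) :
    √(t ^ 2 + 4 * v ^ 2) - 2 * v =
      t ^ 2 / (4 * v) - (√(t ^ 2 + 4 * v ^ 2) - 2 * v) ^ 2 / (4 * v) := by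
  have hs := Real.sq_sqrt (show 0 ≤ t ^ 2 + 4 * v ^ 2 by positivity)
  field_simp
  linear_combination hs

theorem sqrt_sq_add_sub_le (hv : 0 < v) (t : ℝ) :
    √(t ^ 2 + 4 * v ^ 2) - 2 * v ≤ t ^ 2 / (4 * v) := by
  have h := sqrt_sq_add_sub_eq hv t
  have : 0 ≤ (√(t ^ 2 + 4 * v ^ 2) - 2 * v) ^ 2 / (4 * v) := by positivity
  linarith

theorem half_le_two_mul_one_sub_optimalCorrelation (hv : 0 < v) {t : ℝ} (h0 : 0 ≤ t)
    (h1 : t ≤ 2 * v) : t / 2 ≤ 2 * v * (1 - optimalCorrelation v t) := by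
  have h := sqrt_sq_add_sub_le hv t
  have h2 : t ^ 2 / (4 * v) ≤ t / 2 := by
    rw [div_le_div_iff₀ (by linarith) two_pos]
    nlinarith
  have h3 : 2 * v * (1 - optimalCorrelation v t) = t - (√(t ^ 2 + 4 * v ^ 2) - 2 * v) := by
    rw [optimalCorrelation]
    field_simp
    ring
  rw [h3]
  linarith

theorem continuous_optimalCorrelation (v : ℝ) : Continuous (optimalCorrelation v) := by
  unfold optimalCorrelation
  fun_prop

variable {L : ℕ}

/-- For every small distortion there is an inverse multiplier at which the optimal correlations
exhaust it. -/
theorem exists_inverse_multiplier (hL : 0 < L) {v : Fin L → ℝ} (hv : ∀ l, 0 < v l) :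
    ∃ τ : ℝ → ℝ, ∀ᶠ ε : ℝ in 𝓝[>] 0, 0 < τ ε ∧ τ ε ≤ 2 * ε ∧
      ∑ l, 2 * v l * (1 - optimalCorrelation (v l) (τ ε)) = ε := by
  have : Nonempty (Fin L) := ⟨⟨0, hL⟩⟩
  obtain ⟨l₀, hl₀⟩ := Finite.exists_min v
  set b : ℝ → ℝ := fun t => ∑ l, 2 * v l * (1 - optimalCorrelation (v l) t) with hb
  have hcont : Continuous b := by
    have := fun l => continuous_optimalCorrelation (v l)
    fun_prop
  have hb0 : b 0 = 0 := by
    refine Finset.sum_eq_zero fun l _ => ?_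
    have h : optimalCorrelation (v l) 0 = 1 := by
      have := (hv l).ne'
      rw [optimalCorrelation, show (0 : ℝ) ^ 2 + 4 * v l ^ 2 = (2 * v l) ^ 2 by ring,
        Real.sqrt_sq (by linarith [hv l]), sub_zero, div_self (by positivity)]
    rw [h]
    ring
  have hlow : ∀ t, 0 ≤ t → t ≤ 2 * v l₀ → t / 2 ≤ b t := by
    intro t h0 h1
    have hle : ∀ l, t / 2 ≤ 2 * v l * (1 - optimalCorrelation (v l) t) := fun l =>
      half_le_two_mul_one_sub_optimalCorrelation (hv l) h0 (h1.trans (by linarith [hl₀ l]))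
    exact (hle l₀).trans (Finset.single_le_sum (f := fun l => 2 * v l *
      (1 - optimalCorrelation (v l) t)) (fun l _ => (by linarith : 0 ≤ t / 2).trans (hle l))
      (Finset.mem_univ l₀))
  have hex : ∀ ε : ℝ, ∃ t, ε ∈ Set.Ioo 0 (v l₀) → 0 < t ∧ t ≤ 2 * ε ∧ b t = ε := by
    intro ε
    by_cases hε : ε ∈ Set.Ioo 0 (v l₀)
    · have hT : (0 : ℝ) ≤ 2 * v l₀ := by linarith [hv l₀]
      -- At `t = 2 * v l₀`, with `v l₀` the least variance, the distortion is at least `v l₀`, so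
      -- every `ε` below that is attained.
      obtain ⟨t, ht, hbt⟩ := intermediate_value_Icc hT hcont.continuousOn
        (show ε ∈ Set.Icc (b 0) (b (2 * v l₀)) from
          ⟨hb0.le.trans hε.1.le, by linarith [hlow _ hT le_rfl, hε.2]⟩)
      refine ⟨t, fun _ => ⟨lt_of_le_of_ne ht.1 ?_, ?_, hbt⟩⟩
      · rintro rfl
        exact hε.1.ne (hb0.symm.trans hbt)
      · linarith [hlow t ht.1 ht.2]
    · exact ⟨0, fun h => absurd h hε⟩
  choose τ hτ using hex
  refine ⟨τ, ?_⟩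
  filter_upwards [Ioo_mem_nhdsGT (hv l₀)] with ε hε using hτ ε hε

end Correlation

/-! ### Asymptotic expansions in the distortion. -/

section Expansion

theorem abs_log_sub_le {x : ℝ} (hx : 1 / 2 ≤ x) :
    |Real.log x - (x - 1)| ≤ 2 * (x - 1) ^ 2 := by
  have h0 : 0 < x := by linarith
  have h1 := Real.log_le_sub_one_of_pos h0
  have h2 := Real.one_sub_inv_le_log_of_pos h0
  have h3 : x - 1 - (1 - x⁻¹) ≤ 2 * (x - 1) ^ 2 := by
    have e : x - 1 - (1 - x⁻¹) = x⁻¹ * (x - 1) ^ 2 := by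
      field_simp
    have : x⁻¹ ≤ 2 := by
      rw [inv_le_comm₀ h0 two_pos]
      linarith
    rw [e]
    exact mul_le_mul_of_nonneg_right this (sq_nonneg _)
  rw [abs_le]
  constructor <;> nlinarith [sq_nonneg (x - 1)]

theorem isBigO_log_sub {l : Filter ℝ} {f g : ℝ → ℝ} (hg : Tendsto g l (𝓝 0))
    (h : (fun x => f x - 1) =O[l] g) :
    (fun x => Real.log (f x) - (f x - 1)) =O[l] fun x => g x ^ 2 := by
  have hf : Tendsto (fun x => f x - 1) l (𝓝 0) := h.trans_tendsto hg
  refine IsBigO.trans (IsBigO.of_bound 2 ?_) (h.pow 2)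
  filter_upwards [hf.eventually (Ioi_mem_nhds (show (-(1 / 2) : ℝ) < 0 by norm_num))] with x hx
  rw [Real.norm_eq_abs, Real.norm_eq_abs, abs_of_nonneg (sq_nonneg (f x - 1))]
  exact abs_log_sub_le (by linarith)

theorem isBigO_div_id {f : ℝ → ℝ} {n : ℕ} (h : f =O[𝓝[>] 0] fun ε : ℝ => ε ^ (n + 1)) :
    (fun ε => f ε / ε) =O[𝓝[>] 0] fun ε : ℝ => ε ^ n := by
  refine (h.mul (isBigO_refl (fun ε : ℝ => ε⁻¹) _)).congr' ?_ ?_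
  · exact Eventually.of_forall fun ε => (div_eq_mul_inv _ _).symm
  · filter_upwards [self_mem_nhdsWithin] with ε hε
    have : ε ≠ 0 := (Set.mem_Ioi.1 hε).ne'
    field_simp
    ring

theorem isBigO_pow_pow_nhdsGT {m n : ℕ} (h : m ≤ n) :
    (fun ε : ℝ => ε ^ n) =O[𝓝[>] 0] fun ε : ℝ => ε ^ m := by
  refine IsBigO.of_bound 1 ?_
  filter_upwards [Ioo_mem_nhdsGT (zero_lt_one' ℝ)] with ε hε
  rw [one_mul, Real.norm_of_nonneg (pow_nonneg hε.1.le _),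
    Real.norm_of_nonneg (pow_nonneg hε.1.le _)]
  exact pow_le_pow_of_le_one hε.1.le hε.2.le h

variable {τ : ℝ → ℝ}

theorem isBigO_sqrt_sub {v : ℝ} (hv : 0 < v) (hτ : τ =O[𝓝[>] 0] fun ε : ℝ => ε) :
    (fun ε => √(τ ε ^ 2 + 4 * v ^ 2) - 2 * v) =O[𝓝[>] 0] fun ε : ℝ => ε ^ 2 := by
  refine IsBigO.trans (IsBigO.of_bound (1 / (4 * v)) (Eventually.of_forall fun ε => ?_)) (hτ.pow 2)
  rw [Real.norm_of_nonneg (two_mul_le_sqrt_sq_add v _), Real.norm_of_nonneg (sq_nonneg _)]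
  exact (sqrt_sq_add_sub_le hv _).trans (le_of_eq (by ring))

theorem isBigO_sqrt_sub_sub {v : ℝ} (hv : 0 < v) (hτ : τ =O[𝓝[>] 0] fun ε : ℝ => ε) :
    (fun ε => √(τ ε ^ 2 + 4 * v ^ 2) - 2 * v - τ ε ^ 2 / (4 * v)) =O[𝓝[>] 0]
      fun ε : ℝ => ε ^ 3 := by
  have h := (((isBigO_sqrt_sub hv hτ).pow 2).const_mul_left (-(1 / (4 * v)))).congr_right
    (fun ε => (pow_mul ε 2 2).symm)
  refine (h.trans (isBigO_pow_pow_nhdsGT (show 3 ≤ 2 * 2 by norm_num))).congr_left fun ε => ?_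
  have := sqrt_sq_add_sub_eq hv (τ ε)
  linear_combination -this

variable {L : ℕ} {v : Fin L → ℝ}

/-- The budget equation is `L * τ` minus the sum of the terms `√(τ ^ 2 + 4 * v l ^ 2) - 2 * v l`,
equal to `ε`. Replacing each by `τ ^ 2 / (4 * v l)` costs `O(ε ^ 3)`. -/
theorem isBigO_inverse_multiplier_sub_sub (hL : 0 < L) (hv : ∀ l, 0 < v l)
    (hτ : τ =O[𝓝[>] 0] fun ε : ℝ => ε)
    (hb : ∀ᶠ ε : ℝ in 𝓝[>] 0, ∑ l, 2 * v l * (1 - optimalCorrelation (v l) (τ ε)) = ε) :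
    (fun ε => τ ε - ε / L - (∑ l, 1 / (4 * v l)) * τ ε ^ 2 / L) =O[𝓝[>] 0]
      fun ε : ℝ => ε ^ 3 := by
  have hL' : (L : ℝ) ≠ 0 := by exact_mod_cast hL.ne'
  have h := (IsBigO.sum fun l (_ : l ∈ Finset.univ) =>
    isBigO_sqrt_sub_sub (hv l) hτ).const_mul_left (1 / (L : ℝ))
  refine h.congr' ?_ (EventuallyEq.refl _ _)
  filter_upwards [hb] with ε hε
  have e : ∀ l, 2 * v l * (1 - optimalCorrelation (v l) (τ ε)) =
      τ ε - (√(τ ε ^ 2 + 4 * v l ^ 2) - 2 * v l) := by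
    intro l
    have := (hv l).ne'
    rw [optimalCorrelation_eq_add (hv l)]
    field_simp
    ring
  simp_rw [e] at hε
  rw [Finset.sum_sub_distrib, Finset.sum_const, Finset.card_univ, Fintype.card_fin,
    nsmul_eq_mul] at hε
  rw [Finset.sum_apply, Finset.sum_sub_distrib, Finset.sum_mul]
  have e2 : ∑ l, τ ε ^ 2 / (4 * v l) = ∑ l, 1 / (4 * v l) * τ ε ^ 2 :=
    Finset.sum_congr rfl fun l _ => by ring
  rw [e2, show ∑ l, (√(τ ε ^ 2 + 4 * v l ^ 2) - 2 * v l) =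
    L * τ ε - ε by linarith]
  field_simp

theorem isBigO_inverse_multiplier_sub (hL : 0 < L) (hv : ∀ l, 0 < v l)
    (hτ : τ =O[𝓝[>] 0] fun ε : ℝ => ε)
    (hb : ∀ᶠ ε : ℝ in 𝓝[>] 0, ∑ l, 2 * v l * (1 - optimalCorrelation (v l) (τ ε)) = ε) :
    (fun ε => τ ε - ε / L) =O[𝓝[>] 0] fun ε : ℝ => ε ^ 2 := by
  have h1 := (isBigO_inverse_multiplier_sub_sub hL hv hτ hb).trans
    (isBigO_pow_pow_nhdsGT (show 2 ≤ 3 by norm_num))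
  have h2 := (hτ.pow 2).const_mul_left ((∑ l, 1 / (4 * v l)) / L)
  refine (h1.add h2).congr_left fun ε => ?_
  ring

theorem isBigO_inverse_multiplier_sq_sub (hL : 0 < L) (hv : ∀ l, 0 < v l)
    (hτ : τ =O[𝓝[>] 0] fun ε : ℝ => ε)
    (hb : ∀ᶠ ε : ℝ in 𝓝[>] 0, ∑ l, 2 * v l * (1 - optimalCorrelation (v l) (τ ε)) = ε) :
    (fun ε => τ ε ^ 2 - ε ^ 2 / L ^ 2) =O[𝓝[>] 0] fun ε : ℝ => ε ^ 3 := by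
  have h1 := isBigO_inverse_multiplier_sub hL hv hτ hb
  have h2 := hτ.add ((isBigO_refl (fun ε : ℝ => ε) (𝓝[>] 0)).const_mul_left (1 / (L : ℝ)))
  refine ((h1.mul h2).congr_left fun ε => ?_).congr_right fun ε => ?_ <;> ring

/-- Second-order expansion of the inverse multiplier in the distortion. -/
theorem isBigO_inverse_multiplier_expansion (hL : 0 < L) (hv : ∀ l, 0 < v l)
    (hτ : τ =O[𝓝[>] 0] fun ε : ℝ => ε)
    (hb : ∀ᶠ ε : ℝ in 𝓝[>] 0, ∑ l, 2 * v l * (1 - optimalCorrelation (v l) (τ ε)) = ε) :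
    (fun ε => τ ε - ε / L - (∑ l, 1 / (4 * v l)) * ε ^ 2 / L ^ 3) =O[𝓝[>] 0]
      fun ε : ℝ => ε ^ 3 := by
  have h1 := isBigO_inverse_multiplier_sub_sub hL hv hτ hb
  have h2 := (isBigO_inverse_multiplier_sq_sub hL hv hτ hb).const_mul_left
    ((∑ l, 1 / (4 * v l)) / L)
  refine (h1.add h2).congr_left fun ε => ?_
  ring

theorem sum_one_div_four_mul (v : Fin L → ℝ) :
    ∑ l, 1 / (4 * v l) = 1 / 4 * ∑ l, 1 / v l := by
  rw [Finset.mul_sum]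
  refine Finset.sum_congr rfl fun l _ => ?_
  rw [one_div_mul_one_div]

/-- The level is `τ * r`, with `r = 1 - τ / (2 * v l) + O(ε ^ 2)`. -/
theorem isBigO_waterLevel_expansion (hL : 0 < L) (hv : ∀ l, 0 < v l)
    (hτ : τ =O[𝓝[>] 0] fun ε : ℝ => ε)
    (hb : ∀ᶠ ε : ℝ in 𝓝[>] 0, ∑ l, 2 * v l * (1 - optimalCorrelation (v l) (τ ε)) = ε)
    (l : Fin L) :
    (fun ε => v l * (1 - optimalCorrelation (v l) (τ ε) ^ 2) -
      (ε / (L : ℝ) - ε ^ 2 / (2 * (L : ℝ) ^ 2 * v l) +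
        ε ^ 2 / (4 * (L : ℝ) ^ 3) * ∑ k, 1 / v k)) =O[𝓝[>] 0] fun ε : ℝ => ε ^ 3 := by
  have h1 := isBigO_inverse_multiplier_expansion hL hv hτ hb
  have h2 := (isBigO_inverse_multiplier_sq_sub hL hv hτ hb).const_mul_left (1 / (2 * v l))
  have h3 := ((hτ.mul (isBigO_sqrt_sub (hv l) hτ)).const_mul_left (1 / (2 * v l))).congr_right
    (fun ε => (pow_succ' ε 2).symm)
  refine ((h1.sub h2).add h3).congr_left fun ε => ?_
  rw [mul_one_sub_optimalCorrelation_sq (hv l), optimalCorrelation_eq_add (hv l),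
    sum_one_div_four_mul]
  have := (hv l).ne'
  have hL' : (L : ℝ) ≠ 0 := by exact_mod_cast hL.ne'
  field_simp
  ring

theorem isBigO_log_inverse_multiplier (hL : 0 < L) (hv : ∀ l, 0 < v l)
    (hτ : τ =O[𝓝[>] 0] fun ε : ℝ => ε)
    (hb : ∀ᶠ ε : ℝ in 𝓝[>] 0, ∑ l, 2 * v l * (1 - optimalCorrelation (v l) (τ ε)) = ε) :
    (fun ε => Real.log (τ ε * L / ε) - (∑ l, 1 / (4 * v l)) * ε / L ^ 2) =O[𝓝[>] 0]
      fun ε : ℝ => ε ^ 2 := by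
  have hL' : (L : ℝ) ≠ 0 := by exact_mod_cast hL.ne'
  have hpos : ∀ᶠ ε : ℝ in 𝓝[>] 0, ε ≠ 0 :=
    eventually_nhdsWithin_of_forall fun ε hε => (Set.mem_Ioi.1 hε).ne'
  have h1 : (fun ε => τ ε * L / ε - 1) =O[𝓝[>] 0] fun ε : ℝ => ε := by
    refine ((isBigO_div_id (n := 1) (isBigO_inverse_multiplier_sub hL hv hτ hb)).const_mul_left
      (L : ℝ)).congr' ?_ (Eventually.of_forall fun ε => pow_one ε)
    filter_upwards [hpos] with ε hε
    field_simp
  have h2 := (isBigO_div_id (n := 2)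
    (isBigO_inverse_multiplier_expansion hL hv hτ hb)).const_mul_left (L : ℝ)
  have h3 := isBigO_log_sub (tendsto_id.mono_left nhdsWithin_le_nhds) h1
  refine (h3.add h2).congr' ?_ (EventuallyEq.refl _ _)
  filter_upwards [hpos] with ε hε
  field_simp
  ring

theorem isBigO_log_optimalCorrelation (hL : 0 < L) (hv : ∀ l, 0 < v l)
    (hτ : τ =O[𝓝[>] 0] fun ε : ℝ => ε)
    (hb : ∀ᶠ ε : ℝ in 𝓝[>] 0, ∑ l, 2 * v l * (1 - optimalCorrelation (v l) (τ ε)) = ε)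
    (l : Fin L) :
    (fun ε => Real.log (optimalCorrelation (v l) (τ ε)) + ε / (2 * v l * L)) =O[𝓝[>] 0]
      fun ε : ℝ => ε ^ 2 := by
  have hL' : (L : ℝ) ≠ 0 := by exact_mod_cast hL.ne'
  have hvl := (hv l).ne'
  have hs := (isBigO_sqrt_sub (hv l) hτ).const_mul_left (1 / (2 * v l))
  have h1 : (fun ε => optimalCorrelation (v l) (τ ε) - 1) =O[𝓝[>] 0] fun ε : ℝ => ε := by
    have hs1 := (hs.trans (isBigO_pow_pow_nhdsGT (show 1 ≤ 2 by norm_num))).congr_right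
      (fun ε => pow_one ε)
    refine (hs1.sub (hτ.const_mul_left (1 / (2 * v l)))).congr_left fun ε => ?_
    rw [optimalCorrelation_eq_add (hv l)]
    ring
  have h2 := (isBigO_inverse_multiplier_sub hL hv hτ hb).const_mul_left (1 / (2 * v l))
  have h3 := isBigO_log_sub (tendsto_id.mono_left nhdsWithin_le_nhds) h1
  refine (h3.add (hs.sub h2)).congr_left fun ε => ?_
  have e := optimalCorrelation_eq_add (hv l) (τ ε)
  have e' : ε / (2 * v l * L) = 1 / (2 * v l) * (ε / L) := by
    field_simp
  rw [e']
  linear_combination -e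

/-- Since `1 - r ^ 2 = τ * r / v l`, its logarithm splits into the main term, `log (τ * L / ε)` and
`log r`. Summed over `l`, the last two contribute `ε / (4 * L)` and `-ε / (2 * L)` times `∑ 1 / v
l`; the factor `-(1 / 2)` gives `ε / (8 * L)`. -/
theorem isBigO_rate_expansion (hL : 0 < L) (hv : ∀ l, 0 < v l)
    (hτ : τ =O[𝓝[>] 0] fun ε : ℝ => ε) (hτ0 : ∀ᶠ ε : ℝ in 𝓝[>] 0, 0 < τ ε)
    (hb : ∀ᶠ ε : ℝ in 𝓝[>] 0, ∑ l, 2 * v l * (1 - optimalCorrelation (v l) (τ ε)) = ε) :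
    (fun ε => ∑ l, -(1 / 2) * Real.log (1 - optimalCorrelation (v l) (τ ε) ^ 2) -
      (1 / 2 * ∑ l, Real.log ((L : ℝ) * v l / ε) + ε / (8 * (L : ℝ)) * ∑ l, 1 / v l))
        =O[𝓝[>] 0] fun ε : ℝ => ε ^ 2 := by
  have hL' : (L : ℝ) ≠ 0 := by exact_mod_cast hL.ne'
  have h := (IsBigO.sum fun l (_ : l ∈ Finset.univ) =>
    (isBigO_log_inverse_multiplier hL hv hτ hb).add
      (isBigO_log_optimalCorrelation hL hv hτ hb l)).const_mul_left (-(1 / 2))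
  refine h.congr' ?_ (EventuallyEq.refl _ _)
  filter_upwards [hτ0, self_mem_nhdsWithin] with ε hε1 hε2
  have hε : ε ≠ 0 := (Set.mem_Ioi.1 hε2).ne'
  have hlog : ∀ l, Real.log (1 - optimalCorrelation (v l) (τ ε) ^ 2) =
      Real.log (τ ε * L / ε) + Real.log (optimalCorrelation (v l) (τ ε)) -
        Real.log (L * v l / ε) := by
    intro l
    have h1 := (optimalCorrelation_pos (hv l) (τ ε)).ne'
    have h2 := (hv l).ne'
    have h3 := hε1.ne'
    rw [one_sub_optimalCorrelation_sq (hv l), ← Real.log_mul (by positivity) h1,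
      ← Real.log_div (by positivity) (by positivity)]
    congr 1
    field_simp
  have hsum : ∑ l, ε / (2 * v l * L) = ε / (2 * L) * ∑ l, 1 / v l := by
    rw [Finset.mul_sum]
    refine Finset.sum_congr rfl fun l _ => ?_
    rw [div_mul_div_comm, mul_one]
    congr 1
    ring
  simp_rw [hlog]
  rw [← Finset.mul_sum]
  simp only [Finset.sum_apply, Finset.sum_add_distrib, Finset.sum_sub_distrib, Finset.sum_const,
    Finset.card_univ, Fintype.card_fin, nsmul_eq_mul, hsum, sum_one_div_four_mul]
  field_simp
  ring

end Expansion

/-! ### The main theorem. -/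

theorem proposition4 {L : ℕ} (hL : 0 < L)
    (covX Θ : Matrix (Fin L) (Fin L) ℝ) (lam : Fin L → ℝ)
    (hcov : covX.PosDef) (hΘ : Θ ∈ Matrix.orthogonalGroup (Fin L) ℝ)
    (hdecomp : covX = Θ.transpose * Matrix.diagonal lam * Θ)
    (m : PerceptionMetric) :
    (∀ᶠ ε : ℝ in 𝓝[>] 0,
      rdpFunction m (multivariateGaussian 0 covX) (ENNReal.ofReal ε) 0 ≠ ⊤) ∧
    (fun ε : ℝ =>
        (rdpFunction m (multivariateGaussian 0 covX) (ENNReal.ofReal ε) 0).toReal -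
          (1 / 2 * ∑ l, Real.log ((L : ℝ) * lam l / ε) +
            ε / (8 * (L : ℝ)) * ∑ l, 1 / lam l))
      =O[𝓝[>] (0 : ℝ)] (fun ε : ℝ => ε ^ 2) ∧
    ∃ γ : ℝ → Fin L → ℝ,
      (∀ᶠ ε : ℝ in 𝓝[>] 0,
        IsWaterLevels m lam (ENNReal.ofReal ε) 0 (γ ε) ∧
          ∀ g : Fin L → ℝ, IsWaterLevels m lam (ENNReal.ofReal ε) 0 g → g = γ ε) ∧
      ∀ l : Fin L,
        (fun ε : ℝ =>
            γ ε l - (ε / (L : ℝ) - ε ^ 2 / (2 * (L : ℝ) ^ 2 * lam l) +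
              ε ^ 2 / (4 * (L : ℝ) ^ 3) * ∑ k, 1 / lam k))
          =O[𝓝[>] (0 : ℝ)] (fun ε : ℝ => ε ^ 3) := by
  have hlam := pos_of_posDef_orthogonal hcov hΘ hdecomp
  have hC := measurePreserving_orthogonal_coordinates hcov.posSemidef hΘ hdecomp
    fun l => (hlam l).le
  obtain ⟨τ, hτ⟩ := exists_inverse_multiplier hL hlam
  have hpos : ∀ᶠ ε : ℝ in 𝓝[>] 0, 0 < τ ε := hτ.mono fun ε h => h.1
  have hb := hτ.mono fun ε h => h.2.2
  have hO : τ =O[𝓝[>] 0] fun ε : ℝ => ε := by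
    refine IsBigO.of_bound 2 ?_
    filter_upwards [hτ, self_mem_nhdsWithin] with ε h hε
    rw [Real.norm_of_nonneg h.1.le, Real.norm_of_nonneg (Set.mem_Ioi.1 hε).le]
    exact h.2.1
  -- The stationarity condition holds with the common multiplier `c = t⁻¹`.
  have hmult : ∀ t : ℝ, 0 < t → ∀ l, optimalCorrelation (lam l) t =
      t⁻¹ * (lam l * (1 - optimalCorrelation (lam l) t ^ 2)) := by
    intro t ht l
    rw [mul_one_sub_optimalCorrelation_sq (hlam l), inv_mul_cancel_left₀ ht.ne']
  have hrate : ∀ᶠ ε : ℝ in 𝓝[>] 0,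
      rdpFunction m (multivariateGaussian 0 covX) (ENNReal.ofReal ε) 0 = ENNReal.ofReal
        (∑ l, -(1 / 2) * Real.log (1 - optimalCorrelation (lam l) (τ ε) ^ 2)) := by
    filter_upwards [hpos, hb] with ε h0 h1
    have h := rdpFunction_zero_eq m hC (sum_orthogonal_coordinates_mul hΘ) hlam
      (fun l => one_sub_optimalCorrelation_sq_pos (hlam l) h0) (inv_nonneg.2 h0.le) (hmult _ h0)
    rwa [h1] at h
  refine ⟨hrate.mono fun ε h => h ▸ ENNReal.ofReal_ne_top, ?_,
    fun ε l => lam l * (1 - optimalCorrelation (lam l) (τ ε) ^ 2), ?_,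
    isBigO_waterLevel_expansion hL hlam hO hb⟩
  · refine (isBigO_rate_expansion hL hlam hO hpos hb).congr' ?_ (EventuallyEq.refl _ _)
    filter_upwards [hrate, hpos] with ε h h0
    rw [h, ENNReal.toReal_ofReal]
    refine Finset.sum_nonneg fun l _ => ?_
    have hr := one_sub_optimalCorrelation_sq_pos (hlam l) h0
    have := Real.log_nonpos hr.le (by linarith [sq_nonneg (optimalCorrelation (lam l) (τ ε))])
    linarith
  · filter_upwards [hpos, hb] with ε h0 h1
    have h := isWaterLevels_zero_iff m hlam (fun l => (optimalCorrelation_pos (hlam l) (τ ε)).le)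
      (fun l => one_sub_optimalCorrelation_sq_pos (hlam l) h0) (inv_nonneg.2 h0.le) (hmult _ h0)
    rw [h1] at h
    exact ⟨(h _).2 rfl, fun g hg => (h g).1 hg⟩
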